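/- Let $d\ge 1$ and let $X=\mathbb R^d_x$ be embedded by $i:x\mapsto(x,0)$ as the subspace $t=0$ of $M=\mathbb R^{2d}=\mathbb R^d_x\times\mathbb R^d_t$; write $(p,\tau)$ for the momenta dual to $(x,t)$, and put $x_0=0$. Fix a constant $\varkappa>0$ and normalise the Fourier transform on $\mathbb R^k$ by $\mathcal F_{x\to p}f=\varkappa^{k}\int e^{-ipx}f(x)\,dx$, $\mathcal F^{-1}_{p\to x}f=(2\pi\varkappa)^{-k}\int e^{ipx}f(p)\,dp$. Let $g:(x',t',p',\tau')\mapsto(x,t,p,\tau)$ be a canonical transformation of $T^*M\setminus 0$, homogeneous of degree $1$ in the momenta, such that A) $g$ maps the fibre of $T^*M\setminus 0$ over $x_0$ onto itself, and $(x_0,x_0)$ is the only point of $X\times X$ over which the graph of $g$ has points; B) the $p$-component $h(p',\tau')$ of $g(0,0,p',\tau')$ is, as a function of $\tau'$, a diffeomorphism of $\mathbb R^d$ if $p'\ne 0$, and of $\mathbb R^d\setminus\{0\}$ if $p'=0$. Suppose that $(x,t,p',\tau')$ are coordinates on the graph of $g$, with a real generating function $S(x,t,p',\tau')$, i.e. the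 graph is given by $x'=\partial S/\partial p'$, $t'=\partial S/\partial\tau'$, $p=\partial S/\partial x$, $\tau=\partial S/\partial t$; that $S$ is smooth for $(p',\tau')\neq0$, homogeneous of degree $1$ in $(p',\tau')$ and (affine) linear in $(x,t)$. Let $\mu(p',\tau')>0$ be smooth outside $0$ and homogeneous of degree $0$, let $a(p',\tau')$ be smooth, and homogeneous of degree $m\in\mathbb R$ for large $(p',\tau')$, and put $a_\mu=\sqrt\mu\,a$. Let $\Phi$ be the quantized canonical transformation on $M$ with Schwartz kernel $$K_\Phi(x,t,x',t')=\mathcal F_{(p',\tau')\to(x',t')}\bigl\{e^{iS(x,t,p',\tau')}a_\mu(p',\tau')\bigr\}.$$ Let $s\in\mathbb R$ with $s<0$ and $s-m-d>0$, and let $$i^!(\Phi)=i^*\,\Phi\,i_*:H^s(X)\to H^{s-d/2}(M)\to H^{s-d/2-m}(M)\to H^{s-m-d}(X)$$ be the trace of $\Phi$, where $i^*$ and $\Phi$ are the continuous extensions to Sobolev spaces of the restriction $u\mapsto u|_X$ and of the operator with kernel $K_\Phi$ on Schwartz functions, and $i_*v=v\otimes\delta_X$. Then the trace is well defined (the three continuous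 operators exist and determine $i^!(\Phi)$ uniquely), and $i^!(\Phi)$ is the integral operator with Schwartz kernel $$K_{i^!(\Phi)}(x,x')=\varkappa^{d}\int\mathcal F_{p'\to x'}\bigl\{e^{iS(x,0,p',\tau')}a_\mu(p',\tau')\bigr\}\,d\tau'.$$ In dual coordinates, $\mathcal F_{x\to p}\,i^!(\Phi)\,\mathcal F^{-1}_{p\to x}$ is the integral operator with Schwartz kernel $$\varkappa^{d}\int\mathcal F_{x\to p}\bigl\{e^{iS(x,0,p',\tau')}a_\mu(p',\tau')\bigr\}\,d\tau'.$$ Here $\mathcal F$ is the partial Fourier transform of tempered distributions, the integrals over $\tau'\in\mathbb R^d$ are integrals of families of tempered distributions (convergent after pairing with any test function), and kernels are tempered distributions on $\mathbb R^d\times\mathbb R^d$. For $\varkappa=1$ the factor $\varkappa^d$ disappears. -/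

import Mathlib

open MeasureTheory FourierTransform TemperedDistribution
open scoped SchwartzMap ContDiff

noncomputable section

/-! ### The local model: `X = ℝ^d` inside `M = ℝ^d × ℝ^d` as the subspace `t = 0` -/

/-- The Euclidean space `ℝ^d`, with coordinate `x`; also its dual, with coordinate `p`. -/
abbrev SpaceX (d : ℕ) : Type := EuclideanSpace ℝ (Fin d)

/-- The Euclidean space `ℝ^d × ℝ^d` of dimension `n = 2d`, with coordinates `(x, t)`; also its
dual, with coordinates `(p, τ)`. -/
abbrev SpaceM (d : ℕ) : Type := EuclideanSpace ℝ (Fin d ⊕ Fin d)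

/-- The point of `ℝ^d × ℝ^d` with coordinates `(x, t)` (or the covector `(p, τ)`). -/
def mkM {d : ℕ} (x t : SpaceX d) : SpaceM d := WithLp.toLp 2 (Sum.elim x t)

/-- The first component, `x` of the point `(x, t)` or `p` of the covector `(p, τ)`. -/
def fstM {d : ℕ} (y : SpaceM d) : SpaceX d := WithLp.toLp 2 (fun j => y (Sum.inl j))

theorem fstM_mkM {d : ℕ} (x t : SpaceX d) : fstM (mkM x t) = x := rfl

/-- The embedding `i : X → M`, `x ↦ (x, 0)`. -/
def embX (d : ℕ) : SpaceX d →L[ℝ] SpaceM d :=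
  LinearMap.toContinuousLinearMap
    { toFun := fun x => mkM x 0
      map_add' := fun x y => by ext (j | j) <;> simp [mkM]
      map_smul' := fun c x => by ext (j | j) <;> simp [mkM] }

theorem embX_apply {d : ℕ} (x : SpaceX d) : embX d x = mkM x 0 := rfl

theorem embX_antilipschitz (d : ℕ) : AntilipschitzWith 1 (embX d) := by
  refine AddMonoidHomClass.antilipschitz_of_bound (embX d) (fun x => ?_)
  simp [embX_apply, mkM, EuclideanSpace.norm_eq]

/-! ### Sobolev spaces -/

section Sobolev

variable (E : Type) [NormedAddCommGroup E] [InnerProductSpace ℝ E] [FiniteDimensional ℝ E]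
  [MeasurableSpace E] [BorelSpace E]

/-- The Sobolev space `H^s(E)` as a subspace of the tempered distributions. -/
def sobolevSubmodule (s : ℝ) : Submodule ℂ 𝓢'(E, ℂ) where
  carrier := {f | MemSobolev s 2 f}
  add_mem' := MemSobolev.add
  zero_mem' := memSobolev_fun_zero E ℂ s 2
  smul_mem' c _ hf := hf.smul c

/-- The Sobolev space `H^s(E)`; it carries the norm `‖(1 + |ξ|²)^(s/2) f^‖` of `L²`. -/
def SobolevSpace (s : ℝ) : Type := sobolevSubmodule E s

variable {E}

instance (s : ℝ) : AddCommGroup (SobolevSpace E s) :=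
  inferInstanceAs (AddCommGroup (sobolevSubmodule E s))

instance (s : ℝ) : Module ℂ (SobolevSpace E s) :=
  inferInstanceAs (Module ℂ (sobolevSubmodule E s))

/-- The tempered distribution underlying an element of `H^s(E)`. -/
def SobolevSpace.toDistr {s : ℝ} : SobolevSpace E s →ₗ[ℂ] 𝓢'(E, ℂ) :=
  (sobolevSubmodule E s).subtype

theorem SobolevSpace.toDistr_injective {s : ℝ} :
    Function.Injective (SobolevSpace.toDistr : SobolevSpace E s →ₗ[ℂ] 𝓢'(E, ℂ)) :=
  Subtype.val_injective

theorem lpToDistr_injective :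
    Function.Injective (Lp.toTemperedDistributionCLM ℂ (volume : Measure E) 2) :=
  LinearMap.ker_eq_bot.mp
    (Lp.ker_toTemperedDistributionCLM_eq_bot (F := ℂ) (μ := (volume : Measure E)) (p := 2))

theorem SobolevSpace.exists_L2 {s : ℝ} (f : SobolevSpace E s) :
    ∃ f' : Lp ℂ 2 (volume : Measure E),
      Lp.toTemperedDistributionCLM ℂ volume 2 f' = besselPotential E ℂ s (toDistr f) :=
  (show MemSobolev s 2 (toDistr f) from Subtype.property f).imp fun _ h => h.symm

/-- The Bessel potential of order `s`, an isomorphism from `H^s(E)` to `L²(E)`. -/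
def SobolevSpace.toL2 (s : ℝ) : SobolevSpace E s →ₗ[ℂ] Lp ℂ 2 (volume : Measure E) where
  toFun f := (exists_L2 f).choose
  map_add' f g := lpToDistr_injective <|
    (exists_L2 (f + g)).choose_spec.trans <| by
      rw [map_add (Lp.toTemperedDistributionCLM ℂ volume 2), map_add toDistr,
        map_add (besselPotential E ℂ s)]
      exact congrArg₂ _ (exists_L2 f).choose_spec.symm (exists_L2 g).choose_spec.symm
  map_smul' c f := lpToDistr_injective <|
    (exists_L2 (c • f)).choose_spec.trans <| by
      rw [RingHom.id_apply, map_smul (Lp.toTemperedDistributionCLM ℂ volume 2), map_smul toDistr,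
        map_smul (besselPotential E ℂ s)]
      exact congrArg _ (exists_L2 f).choose_spec.symm

theorem SobolevSpace.toL2_spec {s : ℝ} (f : SobolevSpace E s) :
    (toL2 s f : 𝓢'(E, ℂ)) = besselPotential E ℂ s (toDistr f) :=
  (exists_L2 f).choose_spec

theorem SobolevSpace.toL2_injective (s : ℝ) :
    Function.Injective (SobolevSpace.toL2 s : SobolevSpace E s →ₗ[ℂ] _) := by
  intro f g h
  apply toDistr_injective
  have h1 : besselPotential E ℂ s (toDistr f) = besselPotential E ℂ s (toDistr g) := by
    rw [← toL2_spec, ← toL2_spec, h]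
  simpa using congrArg (besselPotential E ℂ (-s)) h1

instance (s : ℝ) : NormedAddCommGroup (SobolevSpace E s) :=
  NormedAddCommGroup.induced _ _ (SobolevSpace.toL2 s) (SobolevSpace.toL2_injective s)

instance (s : ℝ) : NormedSpace ℂ (SobolevSpace E s) :=
  NormedSpace.induced ℂ _ _ (SobolevSpace.toL2 s)

theorem SobolevSpace.norm_def {s : ℝ} (f : SobolevSpace E s) : ‖f‖ = ‖toL2 s f‖ := rfl

/-- A Schwartz function as an element of `H^s(E)`. -/
def SobolevSpace.ofSchwartz (s : ℝ) (u : 𝓢(E, ℂ)) : SobolevSpace E s :=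
  (⟨(u : 𝓢'(E, ℂ)), u.memSobolev⟩ : sobolevSubmodule E s)

theorem SobolevSpace.toDistr_ofSchwartz (s : ℝ) (u : 𝓢(E, ℂ)) :
    toDistr (ofSchwartz s u) = (u : 𝓢'(E, ℂ)) := rfl

end Sobolev

/-! ### Schwartz kernels -/

section Tensor

variable {E F : Type} [NormedAddCommGroup E] [NormedSpace ℝ E]
  [NormedAddCommGroup F] [NormedSpace ℝ F]

/-- The tensor product `(φ ⊗ u)(z, z') = φ(z) u(z')` of Schwartz functions. -/
def schwartzTensor (φ : 𝓢(E, ℂ)) (u : 𝓢(F, ℂ)) : 𝓢(E × F, ℂ) where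
  toFun z := φ z.1 * u z.2
  smooth' := ((φ.smooth ⊤).comp contDiff_fst).mul ((u.smooth ⊤).comp contDiff_snd)
  decay' k n := by
    have h1 : ContDiff ℝ ∞ (fun z : E × F => φ z.1) := (φ.smooth ⊤).comp contDiff_fst
    have h2 : ContDiff ℝ ∞ (fun z : E × F => u z.2) := (u.smooth ⊤).comp contDiff_snd
    have b1 (i : ℕ) (z : E × F) :
        ‖iteratedFDeriv ℝ i (fun z : E × F => φ z.1) z‖ ≤ ‖iteratedFDeriv ℝ i φ z.1‖ := by
      have h := ContinuousLinearMap.iteratedFDeriv_comp_right (ContinuousLinearMap.fst ℝ E F)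
        (φ.smooth ⊤) z (i := i) (mod_cast le_top)
      have h' : (φ ∘ (ContinuousLinearMap.fst ℝ E F) : E × F → ℂ) = fun z => φ z.1 := rfl
      rw [h'] at h
      rw [h]
      refine (ContinuousMultilinearMap.norm_compContinuousLinearMap_le _ _).trans ?_
      refine mul_le_of_le_one_right (norm_nonneg _) ?_
      exact Finset.prod_le_one (fun _ _ => norm_nonneg _)
        (fun _ _ => ContinuousLinearMap.norm_fst_le ℝ E F)
    have b2 (i : ℕ) (z : E × F) :
        ‖iteratedFDeriv ℝ i (fun z : E × F => u z.2) z‖ ≤ ‖iteratedFDeriv ℝ i u z.2‖ := by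
      have h := ContinuousLinearMap.iteratedFDeriv_comp_right (ContinuousLinearMap.snd ℝ E F)
        (u.smooth ⊤) z (i := i) (mod_cast le_top)
      have h' : (u ∘ (ContinuousLinearMap.snd ℝ E F) : E × F → ℂ) = fun z => u z.2 := rfl
      rw [h'] at h
      rw [h]
      refine (ContinuousMultilinearMap.norm_compContinuousLinearMap_le _ _).trans ?_
      refine mul_le_of_le_one_right (norm_nonneg _) ?_
      exact Finset.prod_le_one (fun _ _ => norm_nonneg _)
        (fun _ _ => ContinuousLinearMap.norm_snd_le ℝ E F)
    choose C hC using φ.decay'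
    choose C' hC' using u.decay'
    refine ⟨∑ i ∈ Finset.range (n + 1),
      (n.choose i : ℝ) * (C k i * C' 0 (n - i) + C 0 i * C' k (n - i)), fun z => ?_⟩
    have hm := norm_iteratedFDeriv_mul_le h1 h2 z (n := n) (mod_cast le_top)
    refine (mul_le_mul_of_nonneg_left hm (by positivity)).trans ?_
    rw [Finset.mul_sum]
    refine Finset.sum_le_sum (fun i _ => ?_)
    set A := ‖iteratedFDeriv ℝ i φ z.1‖ with hA
    set B := ‖iteratedFDeriv ℝ (n - i) u z.2‖ with hB
    have hk : ‖z‖ ^ k ≤ ‖z.1‖ ^ k + ‖z.2‖ ^ k := by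
      rcases le_total ‖z.1‖ ‖z.2‖ with h | h
      · rw [Prod.norm_def, max_eq_right h]
        exact le_add_of_nonneg_left (by positivity)
      · rw [Prod.norm_def, max_eq_left h]
        exact le_add_of_nonneg_right (by positivity)
    have e1 : ‖z.1‖ ^ k * A ≤ C k i := hC k i z.1
    have e2 : A ≤ C 0 i := (one_mul A).symm.trans_le (hC 0 i z.1)
    have e3 : ‖z.2‖ ^ k * B ≤ C' k (n - i) := hC' k (n - i) z.2
    have e4 : B ≤ C' 0 (n - i) := (one_mul B).symm.trans_le (hC' 0 (n - i) z.2)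
    have pA : 0 ≤ A := norm_nonneg _
    have pB : 0 ≤ B := norm_nonneg _
    calc ‖z‖ ^ k * ((n.choose i : ℝ) * ‖iteratedFDeriv ℝ i (fun z : E × F => φ z.1) z‖ *
          ‖iteratedFDeriv ℝ (n - i) (fun z : E × F => u z.2) z‖)
        ≤ (‖z.1‖ ^ k + ‖z.2‖ ^ k) * ((n.choose i : ℝ) * A * B) := by
          gcongr
          · exact b1 i z
          · exact b2 (n - i) z
      _ = (n.choose i : ℝ) * ((‖z.1‖ ^ k * A) * B + A * (‖z.2‖ ^ k * B)) := by ring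
      _ ≤ _ := by
          have pk : 0 ≤ ‖z.1‖ ^ k * A := by positivity
          have pk' : 0 ≤ ‖z.2‖ ^ k * B := by positivity
          gcongr
          · exact pk.trans e1
          · exact pA.trans e2

theorem schwartzTensor_apply (φ : 𝓢(E, ℂ)) (u : 𝓢(F, ℂ)) (z : E × F) :
    schwartzTensor φ u z = φ z.1 * u z.2 := rfl

/-- The operator `A`, from Schwartz functions to tempered distributions, is the integral operator
with Schwartz kernel `K`: `⟨A u, φ⟩ = ⟨K(z, z'), φ(z) u(z')⟩`. -/
def HasSchwartzKernel (A : 𝓢(F, ℂ) → 𝓢'(E, ℂ)) (K : 𝓢'(E × F, ℂ)) : Prop :=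
  ∀ (u : 𝓢(F, ℂ)) (φ : 𝓢(E, ℂ)), A u φ = K (schwartzTensor φ u)

end Tensor

/-! ### Fourier transforms, normalised by a constant `κ > 0`:
`F f(p) = κ^(dim) ∫ e^(-ipx) f(x) dx` and `F⁻¹ f(x) = (2πκ)^(-dim) ∫ e^(ipx) f(p) dp` -/

section Dilation

variable {E : Type} [NormedAddCommGroup E] [NormedSpace ℝ E]

/-- Dilation by `1 / (2π)`, which relates the kernels `e^(-2πi xp)` and `e^(-ixp)`. -/
def dilate : 𝓢(E, ℂ) →L[ℂ] 𝓢(E, ℂ) :=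
  SchwartzMap.compCLMOfContinuousLinearEquiv ℂ
    (ContinuousLinearEquiv.smulLeft (Units.mk0 (2 * Real.pi)⁻¹ (by positivity)) : E ≃L[ℝ] E)

theorem dilate_apply (u : 𝓢(E, ℂ)) (x : E) : dilate u x = u ((2 * Real.pi)⁻¹ • x) := rfl

end Dilation

section Fourier

variable {E : Type} [NormedAddCommGroup E] [InnerProductSpace ℝ E] [FiniteDimensional ℝ E]
  [MeasurableSpace E] [BorelSpace E]

/-- The integral `κ^(dim) ∫ e^(-ipx) f(x) dx`. -/
def fourierInt (κ : ℝ) (f : E → ℂ) (p : E) : ℂ :=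
  (κ : ℂ) ^ Module.finrank ℝ E * ∫ x, Complex.exp (-Complex.I * (inner ℝ p x : ℝ)) * f x

/-- The integral `(2πκ)^(-dim) ∫ e^(ipx) f(p) dp`. -/
def fourierInvInt (κ : ℝ) (f : E → ℂ) (x : E) : ℂ :=
  ((2 * Real.pi * κ : ℝ) : ℂ)⁻¹ ^ Module.finrank ℝ E *
    ∫ p, Complex.exp (Complex.I * (inner ℝ p x : ℝ)) * f p

/-- The Fourier transform as an operator on Schwartz functions. -/
def fourierS (κ : ℝ) (u : 𝓢(E, ℂ)) : 𝓢(E, ℂ) :=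
  (κ : ℂ) ^ Module.finrank ℝ E • dilate (𝓕 u)

/-- The inverse Fourier transform as an operator on Schwartz functions. -/
def fourierInvS (κ : ℝ) (u : 𝓢(E, ℂ)) : 𝓢(E, ℂ) :=
  ((2 * Real.pi * κ : ℝ) : ℂ)⁻¹ ^ Module.finrank ℝ E • dilate (𝓕⁻ u)

theorem fourierS_apply (κ : ℝ) (u : 𝓢(E, ℂ)) (p : E) : fourierS κ u p = fourierInt κ u p := by
  have h : 𝓕 (u : E → ℂ) ((2 * Real.pi)⁻¹ • p) =
      ∫ x, Complex.exp (-Complex.I * (inner ℝ p x : ℝ)) * u x := by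
    rw [Real.fourier_eq']
    refine integral_congr_ae (Filter.Eventually.of_forall fun x => ?_)
    have hπ : (Real.pi : ℂ) ≠ 0 := by exact_mod_cast Real.pi_ne_zero
    simp only [smul_eq_mul, inner_smul_right, real_inner_comm]
    congr 2
    push_cast
    field_simp
  simp only [fourierS, fourierInt, smul_apply, dilate_apply, smul_eq_mul]
  rw [← h, SchwartzMap.fourier_coe]

theorem fourierInvS_apply (κ : ℝ) (u : 𝓢(E, ℂ)) (x : E) :
    fourierInvS κ u x = fourierInvInt κ u x := by
  have h : 𝓕⁻ (u : E → ℂ) ((2 * Real.pi)⁻¹ • x) =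
      ∫ p, Complex.exp (Complex.I * (inner ℝ p x : ℝ)) * u p := by
    rw [Real.fourierInv_eq']
    refine integral_congr_ae (Filter.Eventually.of_forall fun p => ?_)
    have hπ : (Real.pi : ℂ) ≠ 0 := by exact_mod_cast Real.pi_ne_zero
    simp only [smul_eq_mul, inner_smul_right]
    congr 2
    push_cast
    field_simp
  simp only [fourierInvS, fourierInvInt, smul_apply, dilate_apply, smul_eq_mul]
  rw [← h, SchwartzMap.fourierInv_coe]

/-- The Fourier transform of tempered distributions, `⟨F T, φ⟩ = ⟨T, F φ⟩`. -/
def fourierDistr (κ : ℝ) : 𝓢'(E, ℂ) →L[ℂ] 𝓢'(E, ℂ) :=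
  PointwiseConvergenceCLM.precomp _
    ((κ : ℂ) ^ Module.finrank ℝ E • dilate ∘L FourierTransform.fourierCLM ℂ 𝓢(E, ℂ))

theorem fourierDistr_apply (κ : ℝ) (T : 𝓢'(E, ℂ)) (φ : 𝓢(E, ℂ)) :
    fourierDistr κ T φ = T (fourierS κ φ) := rfl

variable {F : Type} [NormedAddCommGroup F] [InnerProductSpace ℝ F] [FiniteDimensional ℝ F]
  [MeasurableSpace F] [BorelSpace F]

/-- The tempered distribution `D(z, ξ')` is the partial Fourier transform `F_{ξ → ξ'} {f(z, ξ)}` of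
the function `f` in its second variable, in the sense of distributions:
`⟨D, Ψ⟩ = ∫∫ f(z, ξ) (F_{ξ' → ξ} Ψ)(z, ξ) dz dξ`. -/
def IsFourierInSnd (κ : ℝ) (f : E → F → ℂ) (D : 𝓢'(E × F, ℂ)) : Prop :=
  ∀ Ψ : 𝓢(E × F, ℂ),
    Integrable (fun z : E × F => f z.1 z.2 * fourierInt κ (fun ξ' => Ψ (z.1, ξ')) z.2) ∧
    D Ψ = ∫ z : E × F, f z.1 z.2 * fourierInt κ (fun ξ' => Ψ (z.1, ξ')) z.2

/-- The tempered distribution `D(p, ξ)` is the partial Fourier transform `F_{x → p} {f(x, ξ)}` of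
the function `f` in its first variable, in the sense of distributions:
`⟨D, Ψ⟩ = ∫∫ f(x, ξ) (F_{p → x} Ψ)(x, ξ) dx dξ`. -/
def IsFourierInFst (κ : ℝ) (f : E → F → ℂ) (D : 𝓢'(E × F, ℂ)) : Prop :=
  ∀ Ψ : 𝓢(E × F, ℂ),
    Integrable (fun z : E × F => f z.1 z.2 * fourierInt κ (fun p => Ψ (p, z.2)) z.1) ∧
    D Ψ = ∫ z : E × F, f z.1 z.2 * fourierInt κ (fun p => Ψ (p, z.2)) z.1

end Fourier

/-- The distribution `K` is the integral `∫ D_τ dτ` of a family of tempered distributions, in the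
sense of distributions: `⟨K, Ψ⟩ = ∫ ⟨D_τ, Ψ⟩ dτ` for every test function `Ψ`. -/
def IsDistrIntegral {E F : Type} [MeasureSpace E] [NormedAddCommGroup F] [NormedSpace ℝ F]
    (D : E → 𝓢'(F, ℂ)) (K : 𝓢'(F, ℂ)) : Prop :=
  ∀ Ψ : 𝓢(F, ℂ), Integrable (fun τ => D τ Ψ) ∧ K Ψ = ∫ τ, D τ Ψ

/-! ### Boundary and coboundary operators and the trace of an operator -/

/-- Restriction `u ↦ u|_X` of Schwartz functions from `M` to `X`. -/
def restrictX (d : ℕ) : 𝓢(SpaceM d, ℂ) →L[ℂ] 𝓢(SpaceX d, ℂ) :=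
  SchwartzMap.compCLMOfAntilipschitz ℂ (embX d).hasTemperateGrowth (embX_antilipschitz d)

theorem restrictX_apply {d : ℕ} (u : 𝓢(SpaceM d, ℂ)) (x : SpaceX d) :
    restrictX d u x = u (mkM x 0) := rfl

/-- The distribution `v ⊗ δ_X` on `M`, that is `⟨v ⊗ δ_X, φ⟩ = ⟨v, φ|_X⟩`. -/
def tensorDelta (d : ℕ) : 𝓢'(SpaceX d, ℂ) →L[ℂ] 𝓢'(SpaceM d, ℂ) :=
  PointwiseConvergenceCLM.precomp _ (restrictX d)

theorem tensorDelta_apply {d : ℕ} (v : 𝓢'(SpaceX d, ℂ)) (φ : 𝓢(SpaceM d, ℂ)) :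
    tensorDelta d v φ = v (restrictX d φ) := rfl

/-- `R` is the boundary operator `i^*`: the continuous extension of `u ↦ u|_X`. -/
def IsBoundaryOperator {d : ℕ} {r r' : ℝ}
    (R : SobolevSpace (SpaceM d) r →L[ℂ] SobolevSpace (SpaceX d) r') : Prop :=
  ∀ u : 𝓢(SpaceM d, ℂ), R (.ofSchwartz r u) = .ofSchwartz r' (restrictX d u)

/-- `J` is the coboundary operator `i_*`, `v ↦ v ⊗ δ_X`. -/
def IsCoboundaryOperator {d : ℕ} {r r' : ℝ}
    (J : SobolevSpace (SpaceX d) r →L[ℂ] SobolevSpace (SpaceM d) r') : Prop :=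
  ∀ v : SobolevSpace (SpaceX d) r, (J v).toDistr = tensorDelta d v.toDistr

/-- `T` is the trace `i^! Φ = i^* Φ i_* : H^s(X) → H^(s-m-d)(X)` of the operator `Φ` on `M` of order
`m` with Schwartz kernel `K`: the composition of the continuous operators
`i_* : H^s(X) → H^(s-d/2)(M)`, `Φ : H^(s-d/2)(M) → H^(s-d/2-m)(M)` and
`i^* : H^(s-d/2-m)(M) → H^(s-m-d)(X)`, where `d` is the codimension of `X`. -/
def IsTrace {d : ℕ} (K : 𝓢'(SpaceM d × SpaceM d, ℂ)) (m s : ℝ)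
    (T : SobolevSpace (SpaceX d) s →L[ℂ] SobolevSpace (SpaceX d) (s - m - d)) : Prop :=
  ∃ (J : SobolevSpace (SpaceX d) s →L[ℂ] SobolevSpace (SpaceM d) (s - d / 2))
    (A : SobolevSpace (SpaceM d) (s - d / 2) →L[ℂ] SobolevSpace (SpaceM d) (s - d / 2 - m))
    (R : SobolevSpace (SpaceM d) (s - d / 2 - m) →L[ℂ] SobolevSpace (SpaceX d) (s - m - d)),
    IsCoboundaryOperator J ∧
    HasSchwartzKernel (fun u => (A (.ofSchwartz _ u)).toDistr) K ∧
    IsBoundaryOperator R ∧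
    T = R ∘L A ∘L J

/-- The operator `F_{x → p} T F⁻¹_{p → x}`, which is `T` in dual coordinates, as an operator from
Schwartz functions to tempered distributions. -/
def dualOperator {d : ℕ} (κ : ℝ) {s r : ℝ}
    (T : SobolevSpace (SpaceX d) s →L[ℂ] SobolevSpace (SpaceX d) r) :
    𝓢(SpaceX d, ℂ) → 𝓢'(SpaceX d, ℂ) :=
  fun u => fourierDistr κ (T (.ofSchwartz s (fourierInvS κ u))).toDistr

/-! ### Quantized canonical transformations -/

/-- `f` restricts to a diffeomorphism from `A` onto `B`. -/
def IsDiffeoOn {E F : Type} [NormedAddCommGroup E] [NormedSpace ℝ E] [NormedAddCommGroup F]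
    [NormedSpace ℝ F] (f : E → F) (A : Set E) (B : Set F) : Prop :=
  ContDiffOn ℝ ∞ f A ∧ Set.MapsTo f A B ∧
    ∃ f' : F → E, ContDiffOn ℝ ∞ f' B ∧ Set.MapsTo f' B A ∧ Set.InvOn f' f A B

/-- The cotangent bundle of `M` without its zero section: the pairs `(y, q)` of a point
`y = (x, t)` and a covector `q = (p, τ) ≠ 0`. -/
def cotangentM (d : ℕ) : Set (SpaceM d × SpaceM d) := {w | w.2 ≠ 0}

/-- The symplectic form `dp ∧ dx + dτ ∧ dt`. -/
def symplecticForm {d : ℕ} (u v : SpaceM d × SpaceM d) : ℝ :=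
  inner ℝ u.2 v.1 - inner ℝ v.2 u.1

/-- `g : (y', q') ↦ (y, q)` is a canonical transformation of `T^*M ∖ 0` which is homogeneous of
degree `1`. -/
structure IsHomogeneousCanonical {d : ℕ} (g : SpaceM d × SpaceM d → SpaceM d × SpaceM d) :
    Prop where
  diffeo : IsDiffeoOn g (cotangentM d) (cotangentM d)
  symplectic : ∀ w ∈ cotangentM d, ∀ u v,
    symplecticForm (fderiv ℝ g w u) (fderiv ℝ g w v) = symplecticForm u v
  homogeneous : ∀ (y q : SpaceM d) (c : ℝ), q ≠ 0 → 0 < c →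
    g (y, c • q) = ((g (y, q)).1, c • (g (y, q)).2)

/-- `(y, q')` are coordinates on the graph of `g : (y', q') ↦ (y, q)`, with generating function
`S(y, q')`: the graph is given by `q = ∂S/∂y`, `y' = ∂S/∂q'`. -/
structure IsGeneratingFunction {d : ℕ} (S : SpaceM d → SpaceM d → ℝ)
    (g : SpaceM d × SpaceM d → SpaceM d × SpaceM d) : Prop where
  smooth : ContDiffOn ℝ ∞ (fun w : SpaceM d × SpaceM d => S w.1 w.2) (cotangentM d)
  homogeneous : ∀ (y q' : SpaceM d) (c : ℝ), q' ≠ 0 → 0 < c → S y (c • q') = c * S y q'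
  graph : ∀ y q y' q' : SpaceM d, q' ≠ 0 →
    (g (y', q') = (y, q) ↔
      q = gradient (fun z => S z q') y ∧ y' = gradient (fun ξ => S y ξ) q')

/-- `g` maps the fiber over the point `x₀ = 0` onto itself, and `(x₀, x₀)` is the only point of
`X × X` over which the graph of `g` has points. -/
structure ConditionA {d : ℕ} (g : SpaceM d × SpaceM d → SpaceM d × SpaceM d) : Prop where
  fiber : g '' {w | w.1 = 0 ∧ w.2 ≠ 0} = {w | w.1 = 0 ∧ w.2 ≠ 0}
  graph : {z : SpaceX d × SpaceX d | ∃ q q' : SpaceM d, q' ≠ 0 ∧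
    g (mkM z.2 0, q') = (mkM z.1 0, q)} = {(0, 0)}

/-- The `p`-component `h(p', τ')` of the restriction of `g` to the fiber over `x₀ = 0` is, as a
function of `τ'`, a diffeomorphism of `ℝ^d` if `p' ≠ 0` and of `ℝ^d ∖ 0` if `p' = 0`. -/
structure ConditionB {d : ℕ} (g : SpaceM d × SpaceM d → SpaceM d × SpaceM d) : Prop where
  diffeo : ∀ p' : SpaceX d, p' ≠ 0 →
    IsDiffeoOn (fun τ' : SpaceX d => fstM (g (0, mkM p' τ')).2) Set.univ Set.univ
  diffeo_zero :
    IsDiffeoOn (fun τ' : SpaceX d => fstM (g (0, mkM 0 τ')).2) {τ' | τ' ≠ 0} {p | p ≠ 0}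

/-- The data of a quantized canonical transformation of order `m` in the local model: a canonical
transformation `g`, the generating function `S` of its graph, a measure on the graph with density
`μ` and an amplitude `a`. -/
structure IsQuantizationData {d : ℕ} (g : SpaceM d × SpaceM d → SpaceM d × SpaceM d)
    (S : SpaceM d → SpaceM d → ℝ) (μ : SpaceM d → ℝ) (a : SpaceM d → ℂ) (m : ℝ) : Prop where
  canonical : IsHomogeneousCanonical g
  condA : ConditionA g
  condB : ConditionB g
  generating : IsGeneratingFunction S g
  /-- `S` is (affine) linear in the physical variables. -/
  linear : ∀ q' : SpaceM d, q' ≠ 0 → ∃ (c : ℝ) (L : SpaceM d →ₗ[ℝ] ℝ), ∀ y, S y q' = c + L y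
  density_pos : ∀ q' : SpaceM d, q' ≠ 0 → 0 < μ q'
  density_smooth : ContDiffOn ℝ ∞ μ {q' | q' ≠ 0}
  density_homogeneous : ∀ (q' : SpaceM d) (c : ℝ), q' ≠ 0 → 0 < c → μ (c • q') = μ q'
  amplitude_smooth : ContDiff ℝ ∞ a
  /-- `a` is homogeneous of degree `m`, after being smoothed near `q' = 0`. -/
  amplitude_homogeneous : ∃ ρ : ℝ, 0 < ρ ∧ ∀ (q' : SpaceM d) (c : ℝ), ρ ≤ ‖q'‖ → 1 ≤ c →
    a (c • q') = (c ^ m : ℝ) * a q'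

/-- The function `e^(iS(y, q')) a_μ(q')`, where `a_μ = √μ · a`. -/
def fioSymbol {d : ℕ} (S : SpaceM d → SpaceM d → ℝ) (μ : SpaceM d → ℝ) (a : SpaceM d → ℂ)
    (y q' : SpaceM d) : ℂ :=
  Complex.exp (Complex.I * (S y q' : ℝ)) * ((Real.sqrt (μ q') : ℝ) * a q')

end

/-!
Write `y = (x, t)`, `q' = (p', τ')`. As `g` preserves the fiber over `x₀ = 0`, the graph condition
gives `∂S/∂q' (0, q') = 0`, so `S (0, q') = 0` by Euler's identity; being affine in `y`, the
generating function is `S (y, q') = ⟨y, G(q')⟩`, where `G` is the map that `g` induces on the fiber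
(`IsQuantizationData.generating_eq`). Hence, up to powers of `κ` and dilations by `2π`, the
operator with kernel `K_Φ` is

  `⟨Φ u, φ⟩ = ∫ a_μ(q) (𝓕⁻ φ)(G q) (𝓕 u)(q) dq`,

and everything takes place on the Fourier side. There `H^s` is `L²` with the weight `⟨ξ⟩^s`
(`SobolevSpace.hat`, `SobolevSpace.toDistr_apply`), and the three factors of the trace become
elementary:

* `i_*` is `h ↦ h(p)` with weights, bounded because `∫ ⟨(p, τ)⟩^(2s - d) dτ` is a multiple of
  `⟨p⟩^(2s)` for `s < 0` (`integral_bracket_mkM`, `exists_coboundary_L2`);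
* `i^*` is integration over `τ`, the adjoint of the former operator for the exponent `-(s - m - d)`
  (`exists_isBoundaryOperator`), because restriction to `X` is integration over `τ` on the Fourier
  side (`fourier_restrictX`);
* `Φ` is the transpose of `h ↦ w · (h ∘ G)` with a bounded weight `w`. This map is bounded on `L²`
  as the Jacobian of `G⁻¹` is homogeneous of degree `0`, hence bounded
  (`exists_map_le_of_homogeneous_inverse`, `exists_phase_L2`).

Uniqueness of the factors comes from the density of Schwartz functions in `H^s`. Composing the
three formulas gives

  `⟨i^!(Φ) v, φ⟩ = ∫ a_μ(q) (𝓕⁻ φ)(pr_p G q) (𝓕 v)(pr_p q) dq`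

for Schwartz functions (`trace_apply_schwartz`). The hypotheses on `s` force `m < -d`, so that
`|a_μ(p', τ')| ≤ C ⟨τ'⟩^m` is integrable in `τ'`; this makes the iterated integral of the kernel
absolutely convergent, and Fubini's theorem identifies the two sides (`trace_of_phase`). The formula
in dual coordinates follows by moving the Fourier transform from one factor of the test function
`φ ⊗ v` to the other.
-/

/-! ### The Fourier side of Sobolev spaces -/

section SobolevHat

variable {E : Type} [NormedAddCommGroup E]

/-- The weight `(1 + |x|²)^(r/2)`. -/
noncomputable def bracket (r : ℝ) (x : E) : ℝ := (1 + ‖x‖ ^ 2) ^ (r / 2)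

theorem bracket_pos (r : ℝ) (x : E) : 0 < bracket r x := by
  unfold bracket; positivity

theorem bracket_mul (r r' : ℝ) (x : E) : bracket r x * bracket r' x = bracket (r + r') x := by
  rw [bracket, bracket, bracket, ← Real.rpow_add (by positivity)]
  congr 1; ring

theorem bracket_zero (x : E) : bracket 0 x = 1 := by simp [bracket]

theorem bracket_neg_mul (r : ℝ) (x : E) : bracket (-r) x * bracket r x = 1 := by
  rw [bracket_mul, neg_add_cancel, bracket_zero]

theorem continuous_bracket (r : ℝ) : Continuous (bracket r : E → ℝ) := by
  unfold bracket
  exact Continuous.rpow_const (by fun_prop) fun x => Or.inl (by positivity)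

theorem bracket_le_one {r : ℝ} (hr : r ≤ 0) (x : E) : bracket r x ≤ 1 :=
  Real.rpow_le_one_of_one_le_of_nonpos (by nlinarith [sq_nonneg ‖x‖]) (by linarith)

theorem bracket_le_of_norm_le {F : Type} [NormedAddCommGroup F] {r : ℝ} (hr : r ≤ 0) {x : E}
    {y : F} (h : ‖y‖ ≤ ‖x‖) : bracket r x ≤ bracket r y :=
  Real.rpow_le_rpow_of_nonpos (by positivity) (by gcongr) (by linarith)

variable [InnerProductSpace ℝ E]

theorem hasTemperateGrowth_bracket (r : ℝ) :
    Function.HasTemperateGrowth (fun x : E => (bracket r x : ℂ)) := by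
  unfold bracket
  fun_prop

variable [FiniteDimensional ℝ E] [MeasurableSpace E] [BorelSpace E]

theorem SobolevSpace.toL2_surjective (s : ℝ) :
    Function.Surjective (SobolevSpace.toL2 s : SobolevSpace E s →ₗ[ℂ] _) := by
  intro h
  have hmem : MemSobolev s 2 (besselPotential E ℂ (-s) (h : 𝓢'(E, ℂ))) := ⟨h, by simp⟩
  refine ⟨(⟨_, hmem⟩ : sobolevSubmodule E s), ?_⟩
  apply lpToDistr_injective
  refine (SobolevSpace.toL2_spec _).trans ?_
  change besselPotential E ℂ s (besselPotential E ℂ (-s) (h : 𝓢'(E, ℂ))) = _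
  simp

/-- The weighted Fourier transform `f ↦ ⟨ξ⟩^s (𝓕 f)(ξ)`, an isometry of `H^s` onto `L²`. Here `𝓕`
has the kernel `e^(-2πi xξ)`. -/
noncomputable def SobolevSpace.hat (s : ℝ) :
    SobolevSpace E s ≃ₗᵢ[ℂ] Lp ℂ 2 (volume : Measure E) :=
  (LinearIsometryEquiv.ofSurjective ⟨SobolevSpace.toL2 s, fun _ => rfl⟩
    (SobolevSpace.toL2_surjective s)).trans (Lp.fourierTransformₗᵢ E ℂ)

theorem SobolevSpace.hat_apply {s : ℝ} (f : SobolevSpace E s) : hat s f = 𝓕 (toL2 s f) := rfl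

/-- An element of `H^s` as a functional, in terms of its weighted Fourier transform. -/
theorem SobolevSpace.toDistr_apply {s : ℝ} (f : SobolevSpace E s) (φ : 𝓢(E, ℂ)) :
    toDistr f φ = ∫ ξ, hat s f ξ * (bracket (-s) ξ * 𝓕⁻ φ ξ) := by
  have h : toDistr f = besselPotential E ℂ (-s) (toL2 s f : 𝓢'(E, ℂ)) := by
    rw [toL2_spec]; simp
  rw [h, besselPotential, TemperedDistribution.fourierMultiplierCLM_apply,
    Lp.fourier_toTemperedDistribution_eq, TemperedDistribution.fourierInv_apply,
    TemperedDistribution.smulLeftCLM_apply_apply, Lp.toTemperedDistribution_apply]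
  refine integral_congr_ae (Filter.Eventually.of_forall fun ξ => ?_)
  have := hasTemperateGrowth_bracket (E := E) (-s)
  unfold bracket at this
  simp only [smul_eq_mul]
  rw [SchwartzMap.smulLeftCLM_apply_apply this, hat_apply, smul_eq_mul]
  simp only [bracket]
  ring

theorem SobolevSpace.hat_ofSchwartz (s : ℝ) (u : 𝓢(E, ℂ)) :
    hat s (ofSchwartz s u) =ᵐ[volume] fun ξ => bracket s ξ * 𝓕 u ξ := by
  have ht := hasTemperateGrowth_bracket (E := E) s
  have h : toL2 s (ofSchwartz s u) =
      (SchwartzMap.fourierMultiplierCLM ℂ (fun x : E => (bracket s x : ℂ)) u).toLp 2 := by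
    apply lpToDistr_injective
    refine (toL2_spec _).trans ?_
    rw [toDistr_ofSchwartz, Lp.toTemperedDistributionCLM_apply, Lp.toTemperedDistribution_toLp_eq,
      besselPotential]
    exact fourierMultiplierCLM_toTemperedDistributionCLM_eq ht u
  rw [hat_apply, h, SchwartzMap.toLp_fourier_eq]
  filter_upwards [SchwartzMap.coeFn_toLp
    (𝓕 (SchwartzMap.fourierMultiplierCLM ℂ (fun x : E => (bracket s x : ℂ)) u)) 2 volume] with ξ hξ
  rw [hξ, SchwartzMap.fourierMultiplierCLM_apply, fourier_fourierInv_eq,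
    SchwartzMap.smulLeftCLM_apply_apply ht, smul_eq_mul]

/-- Two elements of `H^s` coincide if their weighted Fourier transforms do almost everywhere. -/
theorem SobolevSpace.ext_hat {s : ℝ} {f g : SobolevSpace E s} {F : E → ℂ}
    (hf : hat s f =ᵐ[volume] F) (hg : hat s g =ᵐ[volume] F) : f = g :=
  (hat s).injective (Lp.ext (hf.trans hg.symm))

theorem SobolevSpace.denseRange_ofSchwartz (s : ℝ) :
    DenseRange (ofSchwartz s : 𝓢(E, ℂ) → SobolevSpace E s) := by
  have h1 : DenseRange (fun u : 𝓢(E, ℂ) => (hat (E := E) s).symm (u.toLp 2)) :=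
    (hat (E := E) s).symm.surjective.denseRange.comp
      (SchwartzMap.denseRange_toLpCLM (p := 2) ENNReal.ofNat_ne_top)
      (hat (E := E) s).symm.continuous
  refine h1.mono ?_
  rintro _ ⟨u, rfl⟩
  have ht := hasTemperateGrowth_bracket (E := E) (-s)
  refine ⟨𝓕⁻ (SchwartzMap.smulLeftCLM ℂ (fun x : E => (bracket (-s) x : ℂ)) u),
    ext_hat (hat_ofSchwartz s _) ?_⟩
  dsimp only
  rw [LinearIsometryEquiv.apply_symm_apply]
  filter_upwards [SchwartzMap.coeFn_toLp u 2 volume] with ξ hξ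
  rw [hξ, fourier_fourierInv_eq, SchwartzMap.smulLeftCLM_apply_apply ht, smul_eq_mul, ← mul_assoc,
    ← Complex.ofReal_mul, mul_comm (bracket s ξ), bracket_neg_mul, Complex.ofReal_one, one_mul]

end SobolevHat

/-! ### Partial Fourier transforms of Schwartz functions -/

section Slice

variable {E F : Type} [NormedAddCommGroup E] [NormedSpace ℝ E]
  [NormedAddCommGroup F] [NormedSpace ℝ F]

theorem norm_iteratedFDeriv_slice_le (Ψ : 𝓢(E × F, ℂ)) (n : ℕ) (x : E) (ξ : F) :
    ‖iteratedFDeriv ℝ n (fun ξ' => Ψ (x, ξ')) ξ‖ ≤ ‖iteratedFDeriv ℝ n Ψ (x, ξ)‖ := by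
  have hΨ : ContDiff ℝ ∞ (fun z : E × F => Ψ ((x, 0) + z)) :=
    (Ψ.smooth ⊤).comp (contDiff_const.add contDiff_id)
  have h := ContinuousLinearMap.iteratedFDeriv_comp_right (ContinuousLinearMap.inr ℝ E F)
    hΨ ξ (i := n) (mod_cast le_top)
  have h' : ((fun z : E × F => Ψ ((x, 0) + z)) ∘ (ContinuousLinearMap.inr ℝ E F) : F → ℂ) =
      fun ξ' => Ψ (x, ξ') := by
    ext ξ'; simp
  rw [h', iteratedFDeriv_comp_add_left] at h
  rw [h]
  refine (ContinuousMultilinearMap.norm_compContinuousLinearMap_le _ _).trans ?_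
  have : ((x, 0) : E × F) + ContinuousLinearMap.inr ℝ E F ξ = (x, ξ) := by simp
  rw [this]
  refine mul_le_of_le_one_right (norm_nonneg _) ?_
  exact Finset.prod_le_one (fun _ _ => norm_nonneg _)
    (fun _ _ => ContinuousLinearMap.norm_inr_le_one ℝ E F)

/-- The Schwartz function `ξ ↦ Ψ(x, ξ)`. -/
noncomputable def sliceSnd (Ψ : 𝓢(E × F, ℂ)) (x : E) : 𝓢(F, ℂ) where
  toFun ξ := Ψ (x, ξ)
  smooth' := (Ψ.smooth ⊤).comp (contDiff_const.prodMk contDiff_id)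
  decay' k n := by
    obtain ⟨C, hC⟩ := Ψ.decay' k n
    refine ⟨C, fun ξ => le_trans ?_ (hC (x, ξ))⟩
    gcongr
    · exact le_max_right _ _
    · exact norm_iteratedFDeriv_slice_le Ψ n x ξ

theorem sliceSnd_add (Ψ Ψ' : 𝓢(E × F, ℂ)) (x : E) :
    sliceSnd (Ψ + Ψ') x = sliceSnd Ψ x + sliceSnd Ψ' x := rfl

theorem sliceSnd_smul (c : ℂ) (Ψ : 𝓢(E × F, ℂ)) (x : E) :
    sliceSnd (c • Ψ) x = c • sliceSnd Ψ x := rfl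

theorem seminorm_sliceSnd_le (N k n : ℕ) (Ψ : 𝓢(E × F, ℂ)) (x : E) :
    SchwartzMap.seminorm ℂ k n (sliceSnd Ψ x) ≤ ((1 + ‖x‖) ^ N)⁻¹ * (2 ^ (N + k) *
      ((Finset.Iic (N + k, n)).sup fun m => SchwartzMap.seminorm ℂ m.1 m.2) Ψ) := by
  refine SchwartzMap.seminorm_le_bound ℂ k n _ (by positivity) fun ξ => ?_
  rw [le_inv_mul_iff₀ (by positivity)]
  have h := SchwartzMap.one_add_le_sup_seminorm_apply (𝕜 := ℂ) (m := (N + k, n)) (k := N + k)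
    (n := n) le_rfl le_rfl Ψ (x, ξ)
  refine le_trans ?_ h
  rw [← mul_assoc, pow_add]
  have h1 : ‖x‖ ≤ ‖(x, ξ)‖ := le_max_left _ _
  have h2 : ‖ξ‖ ≤ 1 + ‖(x, ξ)‖ := (le_max_right _ _).trans (le_add_of_nonneg_left zero_le_one)
  gcongr
  exact norm_iteratedFDeriv_slice_le Ψ n x ξ

theorem continuous_sup_schwartzSeminormFamily (G : Type) [NormedAddCommGroup G] [NormedSpace ℝ G]
    (s : Finset (ℕ × ℕ)) :
    Continuous fun u : 𝓢(G, ℂ) => (s.sup (schwartzSeminormFamily ℂ G ℂ)) u :=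
  Seminorm.continuous_of_continuousAt_zero (Seminorm.continuousAt_zero (r := 1)
    ((schwartz_withSeminorms ℂ G ℂ).hasBasis_zero_ball.mem_of_mem (i := (s, 1)) one_pos))

/-- Applying a continuous operator to the slices of a Schwartz function on `E × F` keeps rapid
decay in both variables. -/
theorem exists_bound_apply_sliceSnd (L : 𝓢(F, ℂ) →L[ℂ] 𝓢(F, ℂ)) (N M : ℕ) :
    ∃ (s : Finset (ℕ × ℕ)) (C : ℝ), 0 ≤ C ∧ ∀ (Ψ : 𝓢(E × F, ℂ)) (x : E) (ξ : F),
      ‖L (sliceSnd Ψ x) ξ‖ ≤ ((1 + ‖x‖) ^ N)⁻¹ * ((1 + ‖ξ‖) ^ M)⁻¹ *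
        (C * (s.sup (schwartzSeminormFamily ℂ (E × F) ℂ)) Ψ) := by
  obtain ⟨t, C, hC0, hC⟩ := Seminorm.bound_of_continuous (schwartz_withSeminorms ℂ F ℂ)
    (((Finset.Iic (M, 0)).sup fun m => SchwartzMap.seminorm ℂ m.1 m.2 :
      Seminorm ℂ 𝓢(F, ℂ)).comp L.toLinearMap) (by
        have := continuous_sup_schwartzSeminormFamily F (Finset.Iic (M, 0))
        exact this.comp L.continuous)
  set s : Finset (ℕ × ℕ) := t.biUnion fun i => Finset.Iic (N + i.1, i.2) with hs
  set c : ℝ := ∑ i ∈ t, 2 ^ (N + i.1) with hc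
  have hc0 : 0 ≤ c := by positivity
  refine ⟨s, 2 ^ M * (C * c), by positivity, fun Ψ x ξ => ?_⟩
  have h1 := SchwartzMap.one_add_le_sup_seminorm_apply (𝕜 := ℂ) (m := (M, 0)) (k := M)
    (n := 0) le_rfl le_rfl (L (sliceSnd Ψ x)) ξ
  rw [norm_iteratedFDeriv_zero] at h1
  have h2 := hC (sliceSnd Ψ x)
  have h3 : (t.sup (schwartzSeminormFamily ℂ F ℂ)) (sliceSnd Ψ x) ≤ ((1 + ‖x‖) ^ N)⁻¹ *
      (c * (s.sup (schwartzSeminormFamily ℂ (E × F) ℂ)) Ψ) := by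
    refine Seminorm.finset_sup_apply_le (by positivity) fun i hi => ?_
    refine (seminorm_sliceSnd_le N i.1 i.2 Ψ x).trans ?_
    gcongr
    · exact Finset.single_le_sum (f := fun i : ℕ × ℕ => (2 : ℝ) ^ (N + i.1))
        (fun _ _ => by positivity) hi
    · exact Finset.sup_mono (f := schwartzSeminormFamily ℂ (E × F) ℂ)
        (Finset.subset_biUnion_of_mem (fun i : ℕ × ℕ => Finset.Iic (N + i.1, i.2)) hi) Ψ
  have h2' : ((Finset.Iic (M, 0)).sup fun m => SchwartzMap.seminorm ℂ m.1 m.2)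
      (L (sliceSnd Ψ x)) ≤ C * (t.sup (schwartzSeminormFamily ℂ F ℂ)) (sliceSnd Ψ x) := h2
  have h4 : (1 + ‖ξ‖) ^ M * ‖L (sliceSnd Ψ x) ξ‖ ≤ 2 ^ M * (C * (((1 + ‖x‖) ^ N)⁻¹ *
      (c * (s.sup (schwartzSeminormFamily ℂ (E × F) ℂ)) Ψ))) := by
    refine h1.trans ?_
    gcongr
    exact h2'.trans (by gcongr)
  rw [← le_inv_mul_iff₀ (by positivity)] at h4
  refine h4.trans (le_of_eq ?_)
  ring

end Slice

section Functional

/-- A linear transform of Schwartz functions into integrable functions, with a bound that makes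
pairing with a bounded function a continuous functional. -/
structure IsIntegrableTransform {G Z : Type} [NormedAddCommGroup G] [NormedSpace ℝ G]
    [MeasureSpace Z] (P : 𝓢(G, ℂ) → Z → ℂ) : Prop where
  add : ∀ Ψ Ψ' z, P (Ψ + Ψ') z = P Ψ z + P Ψ' z
  smul : ∀ (c : ℂ) Ψ z, P (c • Ψ) z = c * P Ψ z
  aestronglyMeasurable : ∀ Ψ, AEStronglyMeasurable (P Ψ) volume
  bound : ∃ (h : Z → ℝ) (s : Finset (ℕ × ℕ)), Integrable h ∧ ∀ Ψ z,
    ‖P Ψ z‖ ≤ h z * (s.sup (schwartzSeminormFamily ℂ G ℂ)) Ψ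

variable {G Z : Type} [NormedAddCommGroup G] [NormedSpace ℝ G] [MeasureSpace Z]
  {P : 𝓢(G, ℂ) → Z → ℂ}

theorem IsIntegrableTransform.integrable (hP : IsIntegrableTransform P) (Ψ : 𝓢(G, ℂ)) :
    Integrable (P Ψ) := by
  obtain ⟨h, s, hh, hb⟩ := hP.bound
  exact (hh.mul_const _).mono' (hP.aestronglyMeasurable Ψ)
    (Filter.Eventually.of_forall fun z => hb Ψ z)

theorem IsIntegrableTransform.exists_distr (hP : IsIntegrableTransform P) {f : Z → ℂ}
    (hf : AEStronglyMeasurable f volume) {B : ℝ} (hB : ∀ z, ‖f z‖ ≤ B) :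
    ∃ D : 𝓢'(G, ℂ), ∀ Ψ, Integrable (fun z => f z * P Ψ z) ∧ D Ψ = ∫ z, f z * P Ψ z := by
  have hint : ∀ Ψ, Integrable (fun z => f z * P Ψ z) := fun Ψ =>
    (hP.integrable Ψ).bdd_mul hf (Filter.Eventually.of_forall hB)
  obtain ⟨h, s, hh, hb⟩ := hP.bound
  let A : 𝓢(G, ℂ) →L[ℂ] ℂ := SchwartzMap.mkCLMtoNormedSpace (𝕜 := ℂ) (fun Ψ => ∫ z, f z * P Ψ z)
    (fun Ψ Ψ' => by
      rw [← integral_add (hint Ψ) (hint Ψ')]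
      simp only [hP.add, mul_add])
    (fun c Ψ => by
      rw [smul_eq_mul, RingHom.id_apply, ← integral_const_mul]
      simp only [hP.smul, mul_left_comm])
    ⟨s, ∫ z, |B| * |h z|, by positivity, fun Ψ => by
      refine (norm_integral_le_integral_norm _).trans ?_
      rw [← integral_mul_const]
      refine integral_mono (hint Ψ).norm ((hh.abs.const_mul _).mul_const _) fun z => ?_
      simp only [norm_mul]
      rw [mul_assoc]
      have h1 := hb Ψ z
      have h2 : h z * (s.sup (schwartzSeminormFamily ℂ G ℂ)) Ψ ≤
        |h z| * (s.sup (schwartzSeminormFamily ℂ G ℂ)) Ψ := by gcongr; exact le_abs_self _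
      exact mul_le_mul ((hB z).trans (le_abs_self _)) (h1.trans h2) (norm_nonneg _) (abs_nonneg _)⟩
  refine ⟨ContinuousLinearMap.toPointwiseConvergenceCLM _ _ _ _ A, fun Ψ => ⟨hint Ψ, rfl⟩⟩

/-- Pairing with a family of bounded functions whose bounds are integrable gives a family of
tempered distributions that can be integrated. -/
theorem IsIntegrableTransform.exists_distr_integral {T : Type} [MeasureSpace T]
    [SFinite (volume : Measure T)] [SFinite (volume : Measure Z)]
    (hP : IsIntegrableTransform P) {f : T → Z → ℂ}
    (hf : ∀ τ, AEStronglyMeasurable (f τ) volume)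
    (hf' : AEStronglyMeasurable (fun w : T × Z => f w.1 w.2) volume) {B : T → ℝ}
    (hB : ∀ τ z, ‖f τ z‖ ≤ B τ) (hBi : Integrable B) :
    ∃ (D : T → 𝓢'(G, ℂ)) (K : 𝓢'(G, ℂ)),
      (∀ τ Ψ, Integrable (fun z => f τ z * P Ψ z) ∧ D τ Ψ = ∫ z, f τ z * P Ψ z) ∧
      IsDistrIntegral D K := by
  choose D hD using fun τ => hP.exists_distr (hf τ) (hB τ)
  have hint : ∀ Ψ, Integrable (fun w : T × Z => f w.1 w.2 * P Ψ w.2) := fun Ψ => by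
    have h2 : AEStronglyMeasurable (fun w : T × Z => P Ψ w.2) volume :=
      (hP.aestronglyMeasurable Ψ).comp_snd
    refine (hBi.mul_prod (hP.integrable Ψ).norm).mono' (hf'.mul h2)
      (Filter.Eventually.of_forall fun w => ?_)
    rw [norm_mul]
    exact mul_le_mul_of_nonneg_right (hB w.1 w.2) (norm_nonneg _)
  have hm : AEStronglyMeasurable (fun z => ∫ τ, f τ z) volume := by
    have h3 : AEStronglyMeasurable (fun w : Z × T => f w.2 w.1) (volume.prod volume) :=
      hf'.prod_swap
    exact h3.integral_prod_right'
  obtain ⟨K, hK⟩ := hP.exists_distr hm (B := ∫ τ, B τ) (fun z =>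
    norm_integral_le_of_norm_le hBi (Filter.Eventually.of_forall fun τ => hB τ z))
  refine ⟨D, K, hD, fun Ψ => ⟨?_, ?_⟩⟩
  · simp only [(hD _ Ψ).2]
    exact (hint Ψ).integral_prod_left
  · simp only [(hD _ Ψ).2, (hK Ψ).2]
    rw [integral_integral_swap (hint Ψ)]
    simp only [integral_mul_const]

end Functional

section PartialFourier

variable {E F : Type} [NormedAddCommGroup E] [InnerProductSpace ℝ E] [FiniteDimensional ℝ E]
  [MeasurableSpace E] [BorelSpace E]
  [NormedAddCommGroup F] [InnerProductSpace ℝ F] [FiniteDimensional ℝ F]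
  [MeasurableSpace F] [BorelSpace F]

theorem integrable_inv_one_add_norm_pow (E : Type) [NormedAddCommGroup E] [InnerProductSpace ℝ E]
    [FiniteDimensional ℝ E] [MeasurableSpace E] [BorelSpace E] :
    Integrable (fun x : E => ((1 + ‖x‖) ^ (Module.finrank ℝ E + 1))⁻¹) := by
  have h := integrable_one_add_norm (E := E) (μ := volume) (r := (Module.finrank ℝ E + 1 : ℕ))
    (by push_cast; linarith)
  refine h.congr (Filter.Eventually.of_forall fun x => ?_)
  dsimp only
  rw [Real.rpow_neg (by positivity), Real.rpow_natCast]

/-- The partial Fourier transform in the second variable. -/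
theorem isIntegrableTransform_fourierSnd (κ : ℝ) :
    IsIntegrableTransform (fun (Ψ : 𝓢(E × F, ℂ)) (z : E × F) =>
      fourierInt κ (fun ξ' => Ψ (z.1, ξ')) z.2) := by
  let L : 𝓢(F, ℂ) →L[ℂ] 𝓢(F, ℂ) :=
    (κ : ℂ) ^ Module.finrank ℝ F • dilate ∘L FourierTransform.fourierCLM ℂ 𝓢(F, ℂ)
  have hL : ∀ (Ψ : 𝓢(E × F, ℂ)) (z : E × F),
      fourierInt κ (fun ξ' => Ψ (z.1, ξ')) z.2 = L (sliceSnd Ψ z.1) z.2 :=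
    fun Ψ z => (fourierS_apply κ (sliceSnd Ψ z.1) z.2).symm
  refine ⟨fun Ψ Ψ' z => ?_, fun c Ψ z => ?_, fun Ψ => ?_, ?_⟩
  · rw [hL, hL, hL, sliceSnd_add, map_add]; rfl
  · rw [hL, hL, sliceSnd_smul, map_smul]; rfl
  · unfold fourierInt
    refine AEStronglyMeasurable.const_mul ?_ _
    have hc : Continuous (fun w : (E × F) × F => Complex.exp (-Complex.I * (inner ℝ w.1.2 w.2 : ℝ)) *
        Ψ (w.1.1, w.2)) := by fun_prop
    exact hc.stronglyMeasurable.integral_prod_right'.aestronglyMeasurable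
  · obtain ⟨s, C, hC0, hC⟩ := exists_bound_apply_sliceSnd (E := E) L (Module.finrank ℝ E + 1)
      (Module.finrank ℝ F + 1)
    refine ⟨fun z => ((1 + ‖z.1‖) ^ (Module.finrank ℝ E + 1))⁻¹ *
      ((1 + ‖z.2‖) ^ (Module.finrank ℝ F + 1))⁻¹ * C, s,
      ((integrable_inv_one_add_norm_pow E).mul_prod (integrable_inv_one_add_norm_pow F)).mul_const C,
      fun Ψ z => ?_⟩
    rw [hL, mul_assoc _ C]
    exact hC Ψ z.1 z.2

theorem exists_isFourierInSnd (κ : ℝ) {f : E → F → ℂ}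
    (hf : AEStronglyMeasurable (fun z : E × F => f z.1 z.2) volume) {B : ℝ}
    (hB : ∀ x ξ, ‖f x ξ‖ ≤ B) : ∃ D, IsFourierInSnd κ f D :=
  (isIntegrableTransform_fourierSnd κ).exists_distr hf fun z => hB z.1 z.2

/-- The partial Fourier transform in the first variable. -/
theorem isIntegrableTransform_fourierFst (κ : ℝ) :
    IsIntegrableTransform (fun (Ψ : 𝓢(E × F, ℂ)) (z : E × F) =>
      fourierInt κ (fun p => Ψ (p, z.2)) z.1) := by
  let R : 𝓢(E × F, ℂ) →L[ℂ] 𝓢(F × E, ℂ) := SchwartzMap.compCLMOfContinuousLinearEquiv ℂ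
    (ContinuousLinearEquiv.prodComm ℝ F E)
  have hR : ∀ (Ψ : 𝓢(E × F, ℂ)) (z : E × F),
      fourierInt κ (fun p => Ψ (p, z.2)) z.1 =
        fourierInt κ (fun ξ' => R Ψ (z.swap.1, ξ')) z.swap.2 := fun Ψ z => rfl
  have H := isIntegrableTransform_fourierSnd (E := F) (F := E) κ
  simp only [hR]
  refine ⟨fun Ψ Ψ' z => ?_, fun c Ψ z => ?_, fun Ψ => ?_, ?_⟩
  · rw [map_add]; exact H.add _ _ _
  · rw [map_smul]; exact H.smul _ _ _
  · exact (H.aestronglyMeasurable (R Ψ)).comp_quasiMeasurePreserving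
      Measure.measurePreserving_swap.quasiMeasurePreserving
  · obtain ⟨h, s, hh, hb⟩ := H.bound
    obtain ⟨t, C, hC0, hC⟩ := Seminorm.bound_of_continuous (schwartz_withSeminorms ℂ (E × F) ℂ)
      ((s.sup (schwartzSeminormFamily ℂ (F × E) ℂ)).comp R.toLinearMap) (by
        have := continuous_sup_schwartzSeminormFamily (F × E) s
        exact this.comp R.continuous)
    refine ⟨fun z => |h z.swap| * C, t, (hh.abs.swap).mul_const _, fun Ψ z => ?_⟩
    refine (hb (R Ψ) z.swap).trans ?_
    rw [mul_assoc]
    exact mul_le_mul (le_abs_self _) (hC Ψ) (apply_nonneg _ _) (abs_nonneg _)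

end PartialFourier

/-! ### The product structure of `M` -/

section Product

variable {d : ℕ}

/-- The second component, `t` of the point `(x, t)` or `τ` of the covector `(p, τ)`. -/
noncomputable def sndM (y : SpaceM d) : SpaceX d := WithLp.toLp 2 (fun j => y (Sum.inr j))

theorem mkM_fstM_sndM (y : SpaceM d) : mkM (fstM y) (sndM y) = y := by
  ext (j | j) <;> rfl

theorem norm_sq_mkM (x t : SpaceX d) : ‖mkM x t‖ ^ 2 = ‖x‖ ^ 2 + ‖t‖ ^ 2 := by
  simp [mkM, EuclideanSpace.norm_sq_eq]

theorem inner_mkM_zero (x : SpaceX d) (q : SpaceM d) :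
    inner ℝ (mkM x 0) q = inner ℝ x (fstM q) := by
  simp [mkM, fstM, PiLp.inner_apply]

theorem norm_snd_le_norm_mkM (x t : SpaceX d) : ‖t‖ ≤ ‖mkM x t‖ := by
  refine le_of_sq_le_sq ?_ (norm_nonneg _)
  rw [norm_sq_mkM]; nlinarith [sq_nonneg ‖x‖]

theorem mkM_ne_zero {x : SpaceX d} (hx : x ≠ 0) (t : SpaceX d) : mkM x t ≠ 0 := by
  intro h
  apply hx
  rw [← fstM_mkM x t, h]; rfl

theorem continuous_mkM : Continuous (fun z : SpaceX d × SpaceX d => mkM z.1 z.2) := by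
  refine (PiLp.continuous_toLp 2 _).comp (continuous_pi fun j => ?_)
  rcases j with j | j <;> simp only [Sum.elim_inl, Sum.elim_inr] <;> fun_prop

theorem continuous_fstM : Continuous (fstM : SpaceM d → SpaceX d) := by
  unfold fstM; fun_prop

theorem continuous_sndM : Continuous (sndM : SpaceM d → SpaceX d) := by
  unfold sndM; fun_prop

/-- The identification of `ℝ^d × ℝ^d` with `M`. -/
noncomputable def mkMEquiv (d : ℕ) : SpaceX d × SpaceX d ≃ᵐ SpaceM d where
  toFun z := mkM z.1 z.2
  invFun y := (fstM y, sndM y)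
  left_inv _ := rfl
  right_inv y := mkM_fstM_sndM y
  measurable_toFun := continuous_mkM.measurable
  measurable_invFun := (continuous_fstM.prodMk continuous_sndM).measurable

theorem measurePreserving_mkMEquiv (d : ℕ) : MeasurePreserving (mkMEquiv d) := by
  have h1 : MeasurePreserving (fun z : SpaceX d × SpaceX d =>
      ((WithLp.ofLp z.1, WithLp.ofLp z.2) : (Fin d → ℝ) × (Fin d → ℝ))) :=
    (PiLp.volume_preserving_ofLp (Fin d)).prod (PiLp.volume_preserving_ofLp (Fin d))
  have h2 := (volume_measurePreserving_sumPiEquivProdPi_symm (fun _ : Fin d ⊕ Fin d => ℝ)).comp h1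
  have h3 := (PiLp.volume_preserving_toLp (Fin d ⊕ Fin d)).comp h2
  convert h3 using 1
  ext z (j | j) <;> rfl

theorem integrable_mkM_iff {f : SpaceM d → ℂ} :
    Integrable (fun z : SpaceX d × SpaceX d => f (mkM z.1 z.2)) ↔ Integrable f :=
  (measurePreserving_mkMEquiv d).integrable_comp_emb (mkMEquiv d).measurableEmbedding

theorem integral_mkM (f : SpaceM d → ℂ) :
    ∫ z : SpaceX d × SpaceX d, f (mkM z.1 z.2) = ∫ q, f q :=
  (measurePreserving_mkMEquiv d).integral_comp (mkMEquiv d).measurableEmbedding f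

theorem quasiMeasurePreserving_fstM :
    Measure.QuasiMeasurePreserving (fstM : SpaceM d → SpaceX d) :=
  Measure.quasiMeasurePreserving_fst.comp
    (measurePreserving_mkMEquiv d).symm.quasiMeasurePreserving

theorem integral_fstM_mul {h : SpaceX d → ℂ} {g : SpaceM d → ℂ}
    (hi : Integrable fun q => h (fstM q) * g q) :
    ∫ q, h (fstM q) * g q = ∫ ξ, h ξ * ∫ η, g (mkM ξ η) := by
  rw [← integral_mkM, Measure.volume_eq_prod, integral_prod _ (by exact integrable_mkM_iff.mpr hi)]
  simp only [fstM_mkM, integral_const_mul]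

end Product

/-! ### Restriction to `X` on the Fourier side -/

section Restriction

variable {d : ℕ}

/-- The Fourier transform of `u|_X` is the integral of the Fourier transform of `u` along the
fibers of `(p, τ) ↦ p`. -/
theorem fourier_restrictX (u : 𝓢(SpaceM d, ℂ)) (ξ : SpaceX d) :
    𝓕 (restrictX d u) ξ = ∫ η, 𝓕 u (mkM ξ η) := by
  set v : 𝓢(SpaceM d, ℂ) := 𝓕 u with hv
  set m : SpaceX d → ℂ := fun ξ => ∫ η, v (mkM ξ η) with hm
  have hvi : Integrable (fun z : SpaceX d × SpaceX d => v (mkM z.1 z.2)) :=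
    integrable_mkM_iff.mpr v.integrable
  have hmi : Integrable m := hvi.integral_prod_left
  have hmc : Continuous m := by
    set N := Module.finrank ℝ (SpaceX d) + 1 with hN
    refine continuous_of_dominated (F := fun ξ η => v (mkM ξ η)) (bound := fun η =>
        ((1 + ‖η‖) ^ N)⁻¹ * (2 ^ N * ((Finset.Iic (N, 0)).sup fun m =>
          SchwartzMap.seminorm ℂ m.1 m.2) v)) ?_ ?_ ?_ ?_
    · intro ξ
      exact (v.continuous.comp (continuous_mkM.comp
        (continuous_const.prodMk continuous_id))).aestronglyMeasurable
    · refine fun ξ => Filter.Eventually.of_forall fun η => ?_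
      rw [le_inv_mul_iff₀ (by positivity)]
      have h := SchwartzMap.one_add_le_sup_seminorm_apply (𝕜 := ℂ) (m := (N, 0)) (k := N)
        (n := 0) le_rfl le_rfl v (mkM ξ η)
      rw [norm_iteratedFDeriv_zero] at h
      refine le_trans ?_ h
      gcongr
      exact norm_snd_le_norm_mkM ξ η
    · exact (integrable_inv_one_add_norm_pow (SpaceX d)).mul_const _
    · refine Filter.Eventually.of_forall fun η => ?_
      exact v.continuous.comp (continuous_mkM.comp (continuous_id.prodMk continuous_const))
  -- the Fourier inversion formula for `u`, with the integral over `η` taken first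
  have hinv : 𝓕⁻ m = restrictX d u := by
    ext x
    have h1 : restrictX d u x = 𝓕⁻ v (mkM x 0) := by
      rw [hv, fourierInv_fourier_eq, restrictX_apply]
    rw [h1, SchwartzMap.fourierInv_coe, Real.fourierInv_eq', Real.fourierInv_eq', ← integral_mkM,
      Measure.volume_eq_prod, integral_prod]
    · refine integral_congr_ae (Filter.Eventually.of_forall fun ξ => ?_)
      simp only [hm, smul_eq_mul, real_inner_comm (mkM x 0), inner_mkM_zero, fstM_mkM,
        integral_const_mul, real_inner_comm x]
    · have hc : Continuous (fun z : SpaceX d × SpaceX d => Complex.exp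
          (↑(2 * Real.pi * inner ℝ (mkM z.1 z.2) (mkM x 0)) * Complex.I)) := by
        have := continuous_mkM (d := d)
        fun_prop
      refine Integrable.bdd_mul (c := 1) hvi hc.aestronglyMeasurable
        (Filter.Eventually.of_forall fun z => ?_)
      rw [Complex.norm_exp_ofReal_mul_I]
  have h2 : 𝓕 (𝓕⁻ m) = m := hmc.fourier_fourierInv_eq hmi (by
    have h3 : 𝓕 m = fun x => restrictX d u (-x) := by
      ext x
      rw [← hinv, Real.fourierInv_eq_fourier_neg, neg_neg]
    rw [h3]
    exact (restrictX d u).integrable.comp_neg)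
  rw [hinv] at h2
  rw [SchwartzMap.fourier_coe, h2]

theorem schwartz_fourierInv_eq_fourier_neg {E : Type} [NormedAddCommGroup E]
    [InnerProductSpace ℝ E] [FiniteDimensional ℝ E] [MeasurableSpace E] [BorelSpace E]
    (u : 𝓢(E, ℂ)) (ξ : E) : 𝓕⁻ u ξ = 𝓕 u (-ξ) := by
  rw [SchwartzMap.fourierInv_coe, SchwartzMap.fourier_coe, Real.fourierInv_eq_fourier_neg]

theorem fourierInv_restrictX (u : 𝓢(SpaceM d, ℂ)) (ξ : SpaceX d) :
    𝓕⁻ (restrictX d u) ξ = ∫ η, 𝓕⁻ u (mkM ξ η) := by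
  rw [schwartz_fourierInv_eq_fourier_neg, fourier_restrictX, ← integral_neg_eq_self]
  refine integral_congr_ae (Filter.Eventually.of_forall fun η => ?_)
  dsimp only
  rw [schwartz_fourierInv_eq_fourier_neg]
  congr 1
  ext (j | j) <;> simp [mkM]

end Restriction

/-! ### Weighted composition operators on `L²` -/

section Composition

variable {Y Z : Type} [MeasureSpace Y] [MeasureSpace Z]

theorem eLpNorm_two_sq {f : Z → ℂ} :
    eLpNorm f 2 volume ^ 2 = ∫⁻ z, ‖f z‖ₑ ^ 2 := by
  have := eLpNorm_nnreal_pow_eq_lintegral (μ := (volume : Measure Z)) (f := f) (p := 2) two_ne_zero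
  simpa [ENNReal.rpow_two] using this

/-- If `∫ |k|² (g ∘ γ) ≤ C ∫ g` for all `g ≥ 0`, then `h ↦ k · (h ∘ γ)` is bounded on `L²`. -/
theorem exists_weighted_comp {k : Z → ℂ} {γ : Z → Y} (hk : AEStronglyMeasurable k volume)
    (hγ : Measure.QuasiMeasurePreserving γ) (C : NNReal)
    (hC : ∀ g : Y → ENNReal, Measurable g → ∫⁻ z, ‖k z‖ₑ ^ 2 * g (γ z) ≤ C * ∫⁻ y, g y) :
    ∃ A : Lp ℂ 2 (volume : Measure Y) →L[ℂ] Lp ℂ 2 (volume : Measure Z),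
      ∀ h, A h =ᵐ[volume] fun z => k z * h (γ z) := by
  have hm : ∀ h : Lp ℂ 2 (volume : Measure Y),
      AEStronglyMeasurable (fun z => k z * h (γ z)) volume := fun h =>
    hk.mul ((Lp.stronglyMeasurable h).aestronglyMeasurable.comp_quasiMeasurePreserving hγ)
  have hsq : ∀ h : Lp ℂ 2 (volume : Measure Y),
      eLpNorm (fun z => k z * h (γ z)) 2 volume ^ 2 ≤ C * eLpNorm h 2 volume ^ 2 := fun h => by
    rw [eLpNorm_two_sq, eLpNorm_two_sq]
    refine le_trans (le_of_eq ?_) (hC (fun y => ‖h y‖ₑ ^ 2)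
      ((Lp.stronglyMeasurable h).measurable.enorm.pow_const 2))
    simp only [enorm_mul, mul_pow]
  have hmem : ∀ h : Lp ℂ 2 (volume : Measure Y), MemLp (fun z => k z * h (γ z)) 2 volume :=
    fun h => ⟨hm h, by
      by_contra hcon
      have h1 := hsq h
      rw [not_lt_top_iff.mp hcon] at h1
      have h2 : (C : ENNReal) * eLpNorm h 2 volume ^ 2 < ⊤ :=
        ENNReal.mul_lt_top ENNReal.coe_lt_top (ENNReal.pow_lt_top (Lp.eLpNorm_lt_top h))
      simp at h1
      exact absurd h1 h2.ne⟩
  let A₀ : Lp ℂ 2 (volume : Measure Y) →ₗ[ℂ] Lp ℂ 2 (volume : Measure Z) :=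
    { toFun := fun h => (hmem h).toLp
      map_add' := fun h h' => by
        refine Lp.ext ?_
        filter_upwards [(hmem (h + h')).coeFn_toLp, (hmem h).coeFn_toLp, (hmem h').coeFn_toLp,
          Lp.coeFn_add (hmem h).toLp (hmem h').toLp, hγ.ae (Lp.coeFn_add h h')] with z h1 h2 h3 h4 h5
        rw [h1, h4, Pi.add_apply, h2, h3, h5, Pi.add_apply, mul_add]
      map_smul' := fun c h => by
        refine Lp.ext ?_
        filter_upwards [(hmem (c • h)).coeFn_toLp, (hmem h).coeFn_toLp,
          Lp.coeFn_smul c (hmem h).toLp, hγ.ae (Lp.coeFn_smul c h)] with z h1 h2 h4 h5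
        rw [h1, RingHom.id_apply, h4, Pi.smul_apply, h2, h5, Pi.smul_apply, smul_eq_mul,
          smul_eq_mul, mul_left_comm] }
  refine ⟨A₀.mkContinuous (Real.sqrt C) fun h => ?_, fun h => (hmem h).coeFn_toLp⟩
  refine le_of_sq_le_sq ?_ (by positivity)
  rw [mul_pow, Real.sq_sqrt C.coe_nonneg]
  change ‖(hmem h).toLp‖ ^ 2 ≤ _
  rw [Lp.norm_toLp, Lp.norm_def, ← ENNReal.toReal_pow, ← ENNReal.toReal_pow,
    ← ENNReal.coe_toReal, ← ENNReal.toReal_mul]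
  exact ENNReal.toReal_mono (ENNReal.mul_lt_top ENNReal.coe_lt_top
    (ENNReal.pow_lt_top (Lp.eLpNorm_lt_top h))).ne (hsq h)

end Composition

/-! ### Boundary and coboundary operators -/

section Boundary

variable {d : ℕ}

theorem integrable_bracket (d : ℕ) {r : ℝ} (hr : r < -d) :
    Integrable (fun η : SpaceX d => bracket r η) := by
  have h := integrable_rpow_neg_one_add_norm_sq (E := SpaceX d) (μ := volume) (r := -r)
    (by rw [finrank_euclideanSpace_fin]; linarith)
  simpa [bracket] using h

theorem bracket_mkM_smul (r : ℝ) (ξ ζ : SpaceX d) :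
    bracket r (mkM ξ (bracket 1 ξ • ζ)) = bracket r ξ * bracket r ζ := by
  have h : bracket 1 ξ ^ 2 = 1 + ‖ξ‖ ^ 2 := by
    rw [bracket, ← Real.rpow_natCast, ← Real.rpow_mul (by positivity)]; simp
  have h' : 1 + ‖mkM ξ (bracket 1 ξ • ζ)‖ ^ 2 = (1 + ‖ξ‖ ^ 2) * (1 + ‖ζ‖ ^ 2) := by
    rw [norm_sq_mkM, norm_smul, Real.norm_of_nonneg (bracket_pos 1 ξ).le, mul_pow, h]
    ring
  rw [bracket, h', Real.mul_rpow (by positivity) (by positivity)]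
  rfl

/-- By the substitution `η = ⟨ξ⟩ ζ`, the integral of a power of `⟨(ξ, η)⟩` along a fiber is a power
of `⟨ξ⟩`. -/
theorem integral_bracket_mkM {r : ℝ} (hr : r < -d) (ξ : SpaceX d) :
    Integrable (fun η : SpaceX d => bracket r (mkM ξ η)) ∧
    ∫ η : SpaceX d, bracket r (mkM ξ η) = bracket (r + d) ξ * ∫ ζ : SpaceX d, bracket r ζ := by
  have hc := bracket_pos 1 ξ
  have hi : Integrable (fun ζ : SpaceX d => bracket r (mkM ξ (bracket 1 ξ • ζ))) := by
    simp only [bracket_mkM_smul]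
    exact (integrable_bracket d hr).const_mul _
  refine ⟨(integrable_comp_smul_iff volume _ hc.ne').mp hi, ?_⟩
  have h := Measure.integral_comp_smul_of_nonneg volume
    (fun η : SpaceX d => bracket r (mkM ξ η)) (bracket 1 ξ) (hR := hc.le)
  simp only [bracket_mkM_smul, integral_const_mul, finrank_euclideanSpace_fin, smul_eq_mul] at h
  have hd : bracket 1 ξ ^ d = bracket d ξ := by
    unfold bracket
    rw [← Real.rpow_natCast, ← Real.rpow_mul (by positivity)]
    congr 1; ring
  rw [hd, eq_inv_mul_iff_mul_eq₀ (bracket_pos _ ξ).ne', ← mul_assoc, bracket_mul] at h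
  rw [← h, add_comm (d : ℝ)]

/-- The operator `h ↦ ⟨p⟩^(-σ) ⟨(p, τ)⟩^(σ - d/2) h(p)` from `L²(X)` to `L²(M)`. On the Fourier side
it is the coboundary operator on `H^σ`, and its adjoint the boundary operator to `H^(-σ)`. -/
theorem exists_coboundary_L2 (d : ℕ) {σ : ℝ} (hσ : σ < 0) :
    ∃ A : Lp ℂ 2 (volume : Measure (SpaceX d)) →L[ℂ] Lp ℂ 2 (volume : Measure (SpaceM d)),
      ∀ h, A h =ᵐ[volume] fun q =>
        ((bracket (-σ) (fstM q) * bracket (σ - d / 2) q : ℝ) : ℂ) * h (fstM q) := by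
  have hk : Continuous fun q : SpaceM d => bracket (-σ) (fstM q) * bracket (σ - d / 2) q :=
    ((continuous_bracket _).comp continuous_fstM).mul (continuous_bracket _)
  refine exists_weighted_comp (Complex.continuous_ofReal.comp hk).aestronglyMeasurable
    quasiMeasurePreserving_fstM (∫ ζ : SpaceX d, bracket (2 * σ - d) ζ).toNNReal fun g hg => ?_
  have hr : 2 * σ - d < -d := by linarith
  have hsq : ∀ q : SpaceM d,
      ‖((bracket (-σ) (fstM q) * bracket (σ - d / 2) q : ℝ) : ℂ)‖ₑ ^ 2 =
        ENNReal.ofReal (bracket (-(2 * σ)) (fstM q)) * ENNReal.ofReal (bracket (2 * σ - d) q) := by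
    intro q
    have h0 := bracket_pos (-σ) (fstM q)
    have h1 := bracket_pos (σ - d / 2) q
    rw [← ofReal_norm, Complex.norm_real, Real.norm_of_nonneg (by positivity),
      ← ENNReal.ofReal_pow (by positivity), ← ENNReal.ofReal_mul (bracket_pos _ _).le, mul_pow, sq,
      sq, bracket_mul, bracket_mul]
    congr 3 <;> ring
  calc ∫⁻ q : SpaceM d, ‖((bracket (-σ) (fstM q) * bracket (σ - d / 2) q : ℝ) : ℂ)‖ₑ ^ 2 *
        g (fstM q)
      = ∫⁻ q : SpaceM d, ENNReal.ofReal (bracket (-(2 * σ)) (fstM q)) * g (fstM q) *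
          ENNReal.ofReal (bracket (2 * σ - d) q) := by
        refine lintegral_congr fun q => ?_
        rw [hsq]; ring
    _ = ∫⁻ z : SpaceX d × SpaceX d, ENNReal.ofReal (bracket (-(2 * σ)) z.1) * g z.1 *
          ENNReal.ofReal (bracket (2 * σ - d) (mkM z.1 z.2)) :=
        ((measurePreserving_mkMEquiv d).lintegral_comp_emb (mkMEquiv d).measurableEmbedding
          (fun q => ENNReal.ofReal (bracket (-(2 * σ)) (fstM q)) * g (fstM q) *
          ENNReal.ofReal (bracket (2 * σ - d) q))).symm
    _ = ∫⁻ ξ : SpaceX d, ∫⁻ η : SpaceX d, ENNReal.ofReal (bracket (-(2 * σ)) ξ) * g ξ *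
          ENNReal.ofReal (bracket (2 * σ - d) (mkM ξ η)) := by
        rw [Measure.volume_eq_prod]
        refine lintegral_prod _ (Measurable.aemeasurable ?_)
        exact (((continuous_bracket _).measurable.comp measurable_fst).ennreal_ofReal.mul
          (hg.comp measurable_fst)).mul
          ((continuous_bracket _).comp continuous_mkM).measurable.ennreal_ofReal
    _ = ∫⁻ ξ : SpaceX d, ENNReal.ofReal (∫ ζ : SpaceX d, bracket (2 * σ - d) ζ) * g ξ := by
        refine lintegral_congr fun ξ => ?_
        obtain ⟨h1, h2⟩ := integral_bracket_mkM hr ξ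
        have hm : Measurable fun η : SpaceX d =>
            ENNReal.ofReal (bracket (2 * σ - d) (mkM ξ η)) :=
          ((continuous_bracket _).comp (continuous_mkM.comp
            (continuous_const.prodMk continuous_id))).measurable.ennreal_ofReal
        rw [lintegral_const_mul _ hm, ← ofReal_integral_eq_lintegral_ofReal h1
          (Filter.Eventually.of_forall fun η => (bracket_pos _ _).le), h2, sub_add_cancel,
          ENNReal.ofReal_mul (bracket_pos _ _).le]
        calc ENNReal.ofReal (bracket (-(2 * σ)) ξ) * g ξ * (ENNReal.ofReal (bracket (2 * σ) ξ) *
              ENNReal.ofReal (∫ ζ : SpaceX d, bracket (2 * σ - d) ζ))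
            = ENNReal.ofReal (bracket (-(2 * σ)) ξ) * ENNReal.ofReal (bracket (2 * σ) ξ) *
              (ENNReal.ofReal (∫ ζ : SpaceX d, bracket (2 * σ - d) ζ) * g ξ) := by ring
          _ = _ := by
            rw [← ENNReal.ofReal_mul (bracket_pos _ _).le, bracket_neg_mul, ENNReal.ofReal_one,
              one_mul]
    _ = ((∫ ζ : SpaceX d, bracket (2 * σ - d) ζ).toNNReal : ENNReal) * ∫⁻ y, g y :=
        lintegral_const_mul _ hg
    _ ≤ _ := le_rfl

theorem memLp_two_bracket_mul {E : Type} [NormedAddCommGroup E] [InnerProductSpace ℝ E]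
    [FiniteDimensional ℝ E] [MeasurableSpace E] [BorelSpace E] (r : ℝ) (u : 𝓢(E, ℂ)) :
    MemLp (fun ξ => bracket r ξ * u ξ) 2 volume := by
  have h := (SchwartzMap.smulLeftCLM ℂ (fun x : E => (bracket r x : ℂ)) u).memLp 2 volume
  refine h.ae_eq (Filter.Eventually.of_forall fun ξ => ?_)
  rw [SchwartzMap.smulLeftCLM_apply_apply (hasTemperateGrowth_bracket r), smul_eq_mul]

/-- The coboundary operator is `h ↦ h(p)` on the Fourier side, up to weights. -/
theorem exists_isCoboundaryOperator (d : ℕ) {σ ρ : ℝ} (hρ : ρ = σ - d / 2)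
    {A : Lp ℂ 2 (volume : Measure (SpaceX d)) →L[ℂ] Lp ℂ 2 (volume : Measure (SpaceM d))}
    (hA : ∀ h, A h =ᵐ[volume] fun q =>
        ((bracket (-σ) (fstM q) * bracket (σ - d / 2) q : ℝ) : ℂ) * h (fstM q)) :
    ∃ J : SobolevSpace (SpaceX d) σ →L[ℂ] SobolevSpace (SpaceM d) ρ,
      IsCoboundaryOperator J ∧ ∀ v, SobolevSpace.hat ρ (J v) = A (SobolevSpace.hat σ v) := by
  let J : SobolevSpace (SpaceX d) σ →L[ℂ] SobolevSpace (SpaceM d) ρ :=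
    ((SobolevSpace.hat (E := SpaceM d) ρ).symm.toContinuousLinearEquiv : _ →L[ℂ] _) ∘L A ∘L
      ((SobolevSpace.hat (E := SpaceX d) σ).toContinuousLinearEquiv : _ →L[ℂ] _)
  have hJ : ∀ v, SobolevSpace.hat ρ (J v) = A (SobolevSpace.hat σ v) := fun v =>
    LinearIsometryEquiv.apply_symm_apply _ _
  refine ⟨J, fun v => ?_, hJ⟩
  ext φ
  set h := SobolevSpace.hat σ v with hh
  rw [tensorDelta_apply, SobolevSpace.toDistr_apply, SobolevSpace.toDistr_apply, hJ]
  have hint : Integrable (fun q => A h q * ((bracket (-ρ) q : ℝ) * 𝓕⁻ φ q)) volume :=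
    (Lp.memLp (A h)).integrable_mul (memLp_two_bracket_mul (-ρ) (𝓕⁻ φ))
  have hae : (fun q => A h q * ((bracket (-ρ) q : ℝ) * 𝓕⁻ φ q)) =ᵐ[volume] fun q =>
      (((bracket (-σ) (fstM q) : ℝ) : ℂ) * h (fstM q)) * 𝓕⁻ φ q := by
    filter_upwards [hA h] with q hq
    rw [hq, ← hρ]
    have := bracket_neg_mul ρ q
    have h1 : ((bracket (-ρ) q : ℝ) : ℂ) * (bracket ρ q : ℝ) = 1 := by exact_mod_cast this
    push_cast
    linear_combination ((bracket (-σ) (fstM q) : ℂ) * h (fstM q) * 𝓕⁻ φ q) * h1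
  rw [integral_congr_ae hae]
  refine (integral_fstM_mul (h := fun ξ => ((bracket (-σ) ξ : ℝ) : ℂ) * h ξ) (g := fun q => 𝓕⁻ φ q)
    (hint.congr hae)).trans ?_
  refine integral_congr_ae (Filter.Eventually.of_forall fun ξ => ?_)
  dsimp only
  rw [fourierInv_restrictX]
  ring

/-- The boundary operator is the adjoint of a coboundary operator on the Fourier side: the first
integrates over the fibers of `(p, τ) ↦ p`, the second is constant along them. -/
theorem exists_isBoundaryOperator (d : ℕ) {σ ρ r : ℝ} (hr : r = -σ) (hρ : ρ = -(σ - d / 2))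
    {A : Lp ℂ 2 (volume : Measure (SpaceX d)) →L[ℂ] Lp ℂ 2 (volume : Measure (SpaceM d))}
    (hA : ∀ h, A h =ᵐ[volume] fun q =>
        ((bracket (-σ) (fstM q) * bracket (σ - d / 2) q : ℝ) : ℂ) * h (fstM q)) :
    ∃ R : SobolevSpace (SpaceM d) ρ →L[ℂ] SobolevSpace (SpaceX d) r,
      IsBoundaryOperator R ∧
      ∀ v, SobolevSpace.hat r (R v) = ContinuousLinearMap.adjoint A (SobolevSpace.hat ρ v) := by
  let R : SobolevSpace (SpaceM d) ρ →L[ℂ] SobolevSpace (SpaceX d) r :=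
    ((SobolevSpace.hat (E := SpaceX d) r).symm.toContinuousLinearEquiv : _ →L[ℂ] _) ∘L
      ContinuousLinearMap.adjoint A ∘L
      ((SobolevSpace.hat (E := SpaceM d) ρ).toContinuousLinearEquiv : _ →L[ℂ] _)
  have hR : ∀ v, SobolevSpace.hat r (R v) =
      ContinuousLinearMap.adjoint A (SobolevSpace.hat ρ v) := fun v =>
    LinearIsometryEquiv.apply_symm_apply _ _
  refine ⟨R, fun u => ?_, hR⟩
  apply (SobolevSpace.hat r).injective
  rw [hR]
  refine ext_inner_left ℂ fun h => ?_
  rw [ContinuousLinearMap.adjoint_inner_right, L2.inner_def, L2.inner_def]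
  have hint : Integrable (fun q => inner ℂ (A h q)
      (SobolevSpace.hat ρ (SobolevSpace.ofSchwartz ρ u) q)) volume := L2.integrable_inner _ _
  have hae : (fun q => inner ℂ (A h q) (SobolevSpace.hat ρ (SobolevSpace.ofSchwartz ρ u) q))
      =ᵐ[volume] fun q =>
        (((bracket (-σ) (fstM q) : ℝ) : ℂ) * starRingEnd ℂ (h (fstM q))) * 𝓕 u q := by
    filter_upwards [hA h, SobolevSpace.hat_ofSchwartz ρ u] with q hq hq'
    rw [hq, hq', RCLike.inner_apply, hρ]
    have := bracket_neg_mul (σ - d / 2) q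
    have h1 : ((bracket (-(σ - d / 2)) q : ℝ) : ℂ) * (bracket (σ - d / 2) q : ℝ) = 1 := by
      exact_mod_cast this
    simp only [map_mul, Complex.conj_ofReal]
    push_cast
    linear_combination
      ((bracket (-σ) (fstM q) : ℂ) * starRingEnd ℂ (h (fstM q)) * 𝓕 u q) * h1
  rw [integral_congr_ae hae]
  refine (integral_fstM_mul (h := fun ξ => ((bracket (-σ) ξ : ℝ) : ℂ) * starRingEnd ℂ (h ξ))
    (g := fun q => 𝓕 u q) (hint.congr hae)).trans ?_
  refine integral_congr_ae ?_
  filter_upwards [SobolevSpace.hat_ofSchwartz r (restrictX d u)] with ξ hξ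
  rw [hξ, RCLike.inner_apply, fourier_restrictX, hr]
  ring

end Boundary

/-! ### The quantized operator on the Fourier side -/

section Quantized

variable {d : ℕ}

/-- The properties of the fiber map `q' ↦ q` of a homogeneous canonical transformation that the
boundedness of the quantized operator on Sobolev spaces rests on. -/
structure IsPhaseMap (G : SpaceM d → SpaceM d) : Prop where
  measurable : Measurable G
  homogeneous : ∀ (q : SpaceM d) (c : ℝ), 0 < c → G (c • q) = c • G q
  norm_le : ∃ C : ℝ, 0 < C ∧ ∀ q, ‖G q‖ ≤ C * ‖q‖
  le_norm : ∃ c : ℝ, 0 < c ∧ ∀ q, c * ‖q‖ ≤ ‖G q‖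
  map_le : ∃ C : NNReal, Measure.map G volume ≤ C • volume

theorem IsPhaseMap.quasiMeasurePreserving {G : SpaceM d → SpaceM d} (hG : IsPhaseMap G) :
    Measure.QuasiMeasurePreserving G := by
  obtain ⟨C, hC⟩ := hG.map_le
  exact ⟨hG.measurable, (Measure.absolutelyContinuous_of_le hC).trans
    Measure.smul_absolutelyContinuous⟩

theorem IsPhaseMap.exists_bracket_le {G : SpaceM d → SpaceM d} (hG : IsPhaseMap G) (r : ℝ) :
    ∃ C : ℝ, 0 < C ∧ ∀ q, bracket r (G q) ≤ C * bracket r q := by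
  rcases le_or_gt 0 r with hr | hr
  · obtain ⟨C, hC0, hC⟩ := hG.norm_le
    refine ⟨(1 + C ^ 2) ^ (r / 2), by positivity, fun q => ?_⟩
    unfold bracket
    rw [← Real.mul_rpow (by positivity) (by positivity)]
    refine Real.rpow_le_rpow (by positivity) ?_ (by linarith)
    have h1 : ‖G q‖ ^ 2 ≤ (C * ‖q‖) ^ 2 := by gcongr; exact hC q
    nlinarith [sq_nonneg C, sq_nonneg ‖q‖]
  · obtain ⟨c, hc0, hc⟩ := hG.le_norm
    have hpos : 0 < c ^ 2 / (1 + c ^ 2) := by positivity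
    refine ⟨(c ^ 2 / (1 + c ^ 2)) ^ (r / 2), by positivity, fun q => ?_⟩
    unfold bracket
    rw [← Real.mul_rpow (by positivity) (by positivity)]
    refine Real.rpow_le_rpow_of_nonpos (by positivity) ?_ (by linarith)
    have h1 : (c * ‖q‖) ^ 2 ≤ ‖G q‖ ^ 2 := by gcongr; exact hc q
    rw [div_mul_eq_mul_div, div_le_iff₀ (by positivity)]
    nlinarith [sq_nonneg c, sq_nonneg ‖q‖, sq_nonneg ‖G q‖,
      mul_nonneg (sq_nonneg c) (sq_nonneg ‖G q‖), mul_nonneg (sq_nonneg c) (sq_nonneg ‖q‖)]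

/-- The weight, on the Fourier side, of the transpose of the quantized operator with phase map `G`
and amplitude `b` as a weighted composition with `G`. The factor `2π` in the argument of `b` comes
from the kernel `e^(-2πi xξ)` of `𝓕`. -/
noncomputable def phaseWeight (κ : ℝ) (G : SpaceM d → SpaceM d) (b : SpaceM d → ℂ) (r r' : ℝ)
    (q : SpaceM d) : ℂ :=
  ((2 * Real.pi * κ : ℝ) : ℂ) ^ (2 * d) * b ((2 * Real.pi) • q) *
    ((bracket (-r) q * bracket r' (G q) : ℝ) : ℂ)

/-- The transpose of the quantized operator of order `m`, on the Fourier side. The weight is bounded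
because `‖G q‖` is comparable to `‖q‖` and the orders `m`, `-r` and `r' = r - m` add up to `0`. -/
theorem exists_phase_L2 (κ : ℝ) {m : ℝ} (hm : m ≤ 0) {G : SpaceM d → SpaceM d}
    (hG : IsPhaseMap G) {b : SpaceM d → ℂ} (hb : Measurable b)
    (hbm : ∃ C, ∀ q, ‖b q‖ ≤ C * bracket m q) {r r' : ℝ} (hr : r' = r - m) :
    ∃ A : Lp ℂ 2 (volume : Measure (SpaceM d)) →L[ℂ] Lp ℂ 2 (volume : Measure (SpaceM d)),
      ∀ h, A h =ᵐ[volume] fun q => starRingEnd ℂ (phaseWeight κ G b r r' q) * h (G q) := by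
  obtain ⟨C₁, hC₁⟩ := hG.map_le
  obtain ⟨C₂, hC₂0, hC₂⟩ := hG.exists_bracket_le r'
  obtain ⟨C₃, hC₃⟩ := hbm
  have hGm := hG.measurable
  have hC₃0 : 0 ≤ C₃ := by
    have := (norm_nonneg _).trans (hC₃ 0)
    exact nonneg_of_mul_nonneg_left this (bracket_pos m 0)
  have hmeas : Measurable (phaseWeight κ G b r r') := by
    unfold phaseWeight
    have h1 := (continuous_bracket (E := SpaceM d) (-r)).measurable
    have h2 := (continuous_bracket (E := SpaceM d) r').measurable.comp hGm
    have h3 : Measurable fun q : SpaceM d => b ((2 * Real.pi) • q) :=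
      hb.comp (measurable_const_smul _)
    exact (h3.const_mul _).mul (Complex.measurable_ofReal.comp (h1.mul h2))
  set B : NNReal := (|2 * Real.pi * κ| ^ (2 * d) * (C₃ * C₂)).toNNReal with hB
  have hbound : ∀ q, ‖starRingEnd ℂ (phaseWeight κ G b r r' q)‖ₑ ≤ B := by
    intro q
    rw [← ofReal_norm, RCLike.norm_conj, hB]
    refine ENNReal.ofReal_le_ofReal ?_
    have hp1 := bracket_pos (-r) q
    have hp2 := bracket_pos r' (G q)
    rw [phaseWeight, norm_mul, norm_mul, norm_pow, Complex.norm_real, Complex.norm_real,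
      Real.norm_eq_abs, Real.norm_of_nonneg (by positivity), mul_assoc]
    refine mul_le_mul_of_nonneg_left ?_ (by positivity)
    have h1 : bracket m ((2 * Real.pi) • q) ≤ bracket m q := by
      refine bracket_le_of_norm_le hm ?_
      rw [norm_smul, Real.norm_of_nonneg (by positivity)]
      have : (1 : ℝ) ≤ 2 * Real.pi := by linarith [Real.two_le_pi]
      exact le_mul_of_one_le_left (norm_nonneg q) this
    calc ‖b ((2 * Real.pi) • q)‖ * (bracket (-r) q * bracket r' (G q))
        ≤ (C₃ * bracket m q) * (bracket (-r) q * (C₂ * bracket r' q)) := by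
          gcongr
          · exact mul_nonneg hC₃0 (bracket_pos m q).le
          · exact (hC₃ _).trans (by gcongr)
          · exact hC₂ q
      _ = C₃ * C₂ * ((bracket m q * bracket (-r) q) * bracket r' q) := by ring
      _ = C₃ * C₂ := by
          rw [bracket_mul, bracket_mul, hr]
          rw [show m + -r + (r - m) = 0 by ring, bracket_zero, mul_one]
  refine exists_weighted_comp ((Complex.continuous_conj.measurable.comp hmeas).aestronglyMeasurable)
    hG.quasiMeasurePreserving (B ^ 2 * C₁) fun g hg => ?_
  calc ∫⁻ q, ‖starRingEnd ℂ (phaseWeight κ G b r r' q)‖ₑ ^ 2 * g (G q)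
      ≤ ∫⁻ q, (B : ENNReal) ^ 2 * g (G q) := by
        refine lintegral_mono fun q => ?_
        gcongr
        exact hbound q
    _ = (B : ENNReal) ^ 2 * ∫⁻ q, g q ∂(Measure.map G volume) := by
        rw [lintegral_const_mul _ (show Measurable fun q => g (G q) from hg.comp hGm), lintegral_map hg hGm]
    _ ≤ (B : ENNReal) ^ 2 * ∫⁻ q, g q ∂(C₁ • volume) := by
        gcongr
    _ = _ := by
        rw [lintegral_smul_measure]
        push_cast
        rw [mul_assoc]
        rfl

/-- The bilinear transpose of a weighted composition operator on `L²`. -/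
theorem integral_adjoint_weighted_comp {Y Z : Type} [MeasureSpace Y] [MeasureSpace Z]
    {A : Lp ℂ 2 (volume : Measure Y) →L[ℂ] Lp ℂ 2 (volume : Measure Z)} {k : Z → ℂ} {γ : Z → Y}
    (hγ : Measure.QuasiMeasurePreserving γ) (hA : ∀ h, A h =ᵐ[volume] fun z => k z * h (γ z))
    (U : Lp ℂ 2 (volume : Measure Z)) {V : Y → ℂ} (hV : MemLp V 2 volume) :
    MemLp (fun z => starRingEnd ℂ (k z) * V (γ z)) 2 volume ∧
    ∫ y, ContinuousLinearMap.adjoint A U y * V y =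
      ∫ z, U z * (starRingEnd ℂ (k z) * V (γ z)) := by
  have hV' : MemLp (fun y => starRingEnd ℂ (V y)) 2 volume := hV.star
  have hae : A hV'.toLp =ᵐ[volume] fun z => k z * starRingEnd ℂ (V (γ z)) := by
    filter_upwards [hA hV'.toLp, hγ.ae hV'.coeFn_toLp] with z h1 h2
    rw [h1, h2]
  constructor
  · refine ((Lp.memLp (A hV'.toLp)).star).ae_eq ?_
    filter_upwards [hae] with z hz
    simp [hz]
  · have h := ContinuousLinearMap.adjoint_inner_right A hV'.toLp U
    rw [L2.inner_def, L2.inner_def] at h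
    calc ∫ y, ContinuousLinearMap.adjoint A U y * V y
        = ∫ y, inner ℂ ((hV'.toLp : Lp ℂ 2 (volume : Measure Y)) y) (ContinuousLinearMap.adjoint A U y) := by
          refine integral_congr_ae ?_
          filter_upwards [hV'.coeFn_toLp] with y hy
          rw [hy, RCLike.inner_apply, Complex.conj_conj]
      _ = ∫ z, inner ℂ (A hV'.toLp z) (U z) := h
      _ = _ := by
          refine integral_congr_ae ?_
          filter_upwards [hae] with z hz
          rw [hz, RCLike.inner_apply, map_mul, Complex.conj_conj]

/-- The adjoint of the weighted composition with `G` gives a bounded operator from `H^r` to `H^r'`,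
which acts on Schwartz functions as the quantized operator with amplitude `b`. -/
theorem exists_quantized_operator (κ : ℝ) {G : SpaceM d → SpaceM d}
    (hG : IsPhaseMap G) {b : SpaceM d → ℂ} {r r' : ℝ}
    {A : Lp ℂ 2 (volume : Measure (SpaceM d)) →L[ℂ] Lp ℂ 2 (volume : Measure (SpaceM d))}
    (hA : ∀ h, A h =ᵐ[volume] fun q => starRingEnd ℂ (phaseWeight κ G b r r' q) * h (G q)) :
    ∃ Φ : SobolevSpace (SpaceM d) r →L[ℂ] SobolevSpace (SpaceM d) r',
      (∀ v, SobolevSpace.hat r' (Φ v) =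
        ContinuousLinearMap.adjoint A (SobolevSpace.hat r v)) ∧
      ∀ u φ : 𝓢(SpaceM d, ℂ), (Φ (.ofSchwartz r u)).toDistr φ =
        ((2 * Real.pi * κ : ℝ) : ℂ) ^ (2 * d) *
          ∫ q, b ((2 * Real.pi) • q) * 𝓕⁻ φ (G q) * 𝓕 u q := by
  let Φ : SobolevSpace (SpaceM d) r →L[ℂ] SobolevSpace (SpaceM d) r' :=
    ((SobolevSpace.hat (E := SpaceM d) r').symm.toContinuousLinearEquiv : _ →L[ℂ] _) ∘L
      ContinuousLinearMap.adjoint A ∘L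
      ((SobolevSpace.hat (E := SpaceM d) r).toContinuousLinearEquiv : _ →L[ℂ] _)
  have hΦ : ∀ v, SobolevSpace.hat r' (Φ v) =
      ContinuousLinearMap.adjoint A (SobolevSpace.hat r v) := fun v =>
    LinearIsometryEquiv.apply_symm_apply _ _
  refine ⟨Φ, hΦ, fun u φ => ?_⟩
  rw [SobolevSpace.toDistr_apply, hΦ, (integral_adjoint_weighted_comp hG.quasiMeasurePreserving hA _
    (memLp_two_bracket_mul (-r') (𝓕⁻ φ))).2, ← integral_const_mul]
  refine integral_congr_ae ?_
  filter_upwards [SobolevSpace.hat_ofSchwartz r u] with q hq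
  rw [hq, Complex.conj_conj, phaseWeight]
  have h1 : ((bracket (-r) q : ℝ) : ℂ) * (bracket r q : ℝ) = 1 := by
    exact_mod_cast bracket_neg_mul r q
  have h2 : ((bracket (-r') (G q) : ℝ) : ℂ) * (bracket r' (G q) : ℝ) = 1 := by
    exact_mod_cast bracket_neg_mul r' (G q)
  push_cast
  linear_combination ((2 * Real.pi * κ : ℂ) ^ (2 * d) * b ((2 * Real.pi) • q) * 𝓕⁻ φ (G q) *
    𝓕 u q) * (bracket (-r') (G q) * bracket r' (G q) * h1 + h2)

/-- The trace of the quantized operator on Schwartz functions: the weights of the three factors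
cancel. -/
theorem trace_apply_schwartz (κ : ℝ) {G : SpaceM d → SpaceM d}
    (hG : IsPhaseMap G) {b : SpaceM d → ℂ} {s ρ ρ' s' : ℝ} (hρ : ρ = s - d / 2)
    (hρ' : ρ' = s' + d / 2)
    {A : Lp ℂ 2 (volume : Measure (SpaceM d)) →L[ℂ] Lp ℂ 2 (volume : Measure (SpaceM d))}
    (hA : ∀ h, A h =ᵐ[volume] fun q => starRingEnd ℂ (phaseWeight κ G b ρ ρ' q) * h (G q))
    {B B' : Lp ℂ 2 (volume : Measure (SpaceX d)) →L[ℂ] Lp ℂ 2 (volume : Measure (SpaceM d))}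
    (hB : ∀ h, B h =ᵐ[volume] fun q =>
      ((bracket (-s) (fstM q) * bracket (s - d / 2) q : ℝ) : ℂ) * h (fstM q))
    (hB' : ∀ h, B' h =ᵐ[volume] fun q =>
      ((bracket (- -s') (fstM q) * bracket (-s' - d / 2) q : ℝ) : ℂ) * h (fstM q))
    {J : SobolevSpace (SpaceX d) s →L[ℂ] SobolevSpace (SpaceM d) ρ}
    {Φ : SobolevSpace (SpaceM d) ρ →L[ℂ] SobolevSpace (SpaceM d) ρ'}
    {R : SobolevSpace (SpaceM d) ρ' →L[ℂ] SobolevSpace (SpaceX d) s'}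
    (hJ : ∀ v, SobolevSpace.hat ρ (J v) = B (SobolevSpace.hat s v))
    (hΦ : ∀ v, SobolevSpace.hat ρ' (Φ v) =
      ContinuousLinearMap.adjoint A (SobolevSpace.hat ρ v))
    (hR : ∀ v, SobolevSpace.hat s' (R v) =
      ContinuousLinearMap.adjoint B' (SobolevSpace.hat ρ' v)) (v φ : 𝓢(SpaceX d, ℂ)) :
    (R (Φ (J (.ofSchwartz s v)))).toDistr φ = ((2 * Real.pi * κ : ℝ) : ℂ) ^ (2 * d) *
      ∫ q, b ((2 * Real.pi) • q) * 𝓕⁻ φ (fstM (G q)) * 𝓕 v (fstM q) := by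
  obtain ⟨hmem, h1⟩ := integral_adjoint_weighted_comp quasiMeasurePreserving_fstM hB'
    (SobolevSpace.hat ρ' (Φ (J (.ofSchwartz s v)))) (memLp_two_bracket_mul (-s') (𝓕⁻ φ))
  rw [SobolevSpace.toDistr_apply, hR, h1, hΦ,
    (integral_adjoint_weighted_comp hG.quasiMeasurePreserving hA _ hmem).2, hJ,
    ← integral_const_mul]
  refine integral_congr_ae ?_
  filter_upwards [hB (SobolevSpace.hat s (.ofSchwartz s v)),
    quasiMeasurePreserving_fstM.ae (SobolevSpace.hat_ofSchwartz s v)] with q hq hq'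
  rw [hq, hq', Complex.conj_conj, phaseWeight, Complex.conj_ofReal, ← hρ]
  have e1 : ((bracket (-ρ) q : ℝ) : ℂ) * (bracket ρ q : ℝ) = 1 := by
    exact_mod_cast bracket_neg_mul ρ q
  have e2 : ((bracket (-s' - d / 2) (G q) : ℝ) : ℂ) * (bracket ρ' (G q) : ℝ) = 1 := by
    rw [show -s' - (d : ℝ) / 2 = -ρ' by rw [hρ']; ring]
    exact_mod_cast bracket_neg_mul ρ' (G q)
  have e3 : ((bracket (-s) (fstM q) : ℝ) : ℂ) * (bracket s (fstM q) : ℝ) = 1 := by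
    exact_mod_cast bracket_neg_mul s (fstM q)
  have e4 : ((bracket (- -s') (fstM (G q)) : ℝ) : ℂ) * (bracket (-s') (fstM (G q)) : ℝ) = 1 := by
    exact_mod_cast bracket_neg_mul (-s') (fstM (G q))
  push_cast
  calc _ = (2 * Real.pi * κ : ℂ) ^ (2 * d) * b ((2 * Real.pi) • q) * 𝓕⁻ φ (fstM (G q)) *
        𝓕 v (fstM q) * (((bracket (-ρ) q : ℝ) : ℂ) * (bracket ρ q : ℝ)) *
        (((bracket (-s' - d / 2) (G q) : ℝ) : ℂ) * (bracket ρ' (G q) : ℝ)) *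
        (((bracket (-s) (fstM q) : ℝ) : ℂ) * (bracket s (fstM q) : ℝ)) *
        (((bracket (- -s') (fstM (G q)) : ℝ) : ℂ) * (bracket (-s') (fstM (G q)) : ℝ)) := by ring
    _ = _ := by rw [e1, e2, e3, e4]; ring

end Quantized

/-! ### Pairing oscillatory kernels with tensor products -/

section Kernels

section General

variable {E F : Type} [NormedAddCommGroup E] [InnerProductSpace ℝ E] [FiniteDimensional ℝ E]
  [MeasurableSpace E] [BorelSpace E]
  [NormedAddCommGroup F] [InnerProductSpace ℝ F] [FiniteDimensional ℝ F]
  [MeasurableSpace F] [BorelSpace F]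

theorem fourierInt_const_mul (κ : ℝ) (c : ℂ) (f : E → ℂ) (p : E) :
    fourierInt κ (fun x => c * f x) p = c * fourierInt κ f p := by
  unfold fourierInt
  simp only [mul_left_comm _ c, integral_const_mul]

theorem fourierInt_mul_const (κ : ℝ) (c : ℂ) (f : E → ℂ) (p : E) :
    fourierInt κ (fun x => f x * c) p = fourierInt κ f p * c := by
  simp only [mul_comm _ c, fourierInt_const_mul]

theorem fourierInt_schwartz (κ : ℝ) (u : 𝓢(E, ℂ)) (p : E) :
    fourierInt κ u p = (κ : ℂ) ^ Module.finrank ℝ E * 𝓕 u ((2 * Real.pi)⁻¹ • p) :=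
  (fourierS_apply κ u p).symm

theorem integral_exp_inner_mul (φ : 𝓢(E, ℂ)) (p : E) :
    ∫ x, Complex.exp (Complex.I * (inner ℝ x p : ℝ)) * φ x = 𝓕⁻ φ ((2 * Real.pi)⁻¹ • p) := by
  rw [SchwartzMap.fourierInv_coe, Real.fourierInv_eq']
  refine integral_congr_ae (Filter.Eventually.of_forall fun x => ?_)
  have hπ : (Real.pi : ℂ) ≠ 0 := by exact_mod_cast Real.pi_ne_zero
  simp only [smul_eq_mul, inner_smul_right]
  congr 2
  push_cast
  field_simp

theorem fourier_dilate (u : 𝓢(E, ℂ)) (ξ : E) :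
    𝓕 (dilate u) ((2 * Real.pi)⁻¹ • ξ) = ((2 * Real.pi : ℝ) : ℂ) ^ Module.finrank ℝ E * 𝓕 u ξ := by
  rw [SchwartzMap.fourier_coe, SchwartzMap.fourier_coe, Real.fourier_eq', Real.fourier_eq']
  have h := Measure.integral_comp_smul_of_nonneg volume
    (fun x : E => Complex.exp (↑(-2 * Real.pi * inner ℝ x ξ) * Complex.I) • u x)
    (2 * Real.pi)⁻¹ (hR := by positivity)
  rw [inv_pow, inv_inv, Complex.real_smul, Complex.ofReal_pow] at h
  rw [← h]
  refine integral_congr_ae (Filter.Eventually.of_forall fun x => ?_)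
  simp only [dilate_apply, inner_smul_left, inner_smul_right]
  rfl

/-- The two normalised transforms are inverse to each other. -/
theorem fourierS_fourierInvS {κ : ℝ} (hκ : 0 < κ) (u : 𝓢(E, ℂ)) :
    fourierS κ (fourierInvS κ u) = u := by
  ext ξ
  have hπ : (Real.pi : ℂ) ≠ 0 := by exact_mod_cast Real.pi_ne_zero
  have hκ' : (κ : ℂ) ≠ 0 := by exact_mod_cast hκ.ne'
  rw [fourierS, fourierInvS, FourierTransform.fourier_smul, smul_apply, map_smul,
    smul_apply, dilate_apply, fourier_dilate, fourier_fourierInv_eq]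
  simp only [smul_eq_mul, ← mul_assoc, ← mul_pow]
  have h : (κ : ℂ) * ((2 * Real.pi * κ : ℝ) : ℂ)⁻¹ * ((2 * Real.pi : ℝ) : ℂ) = 1 := by
    push_cast
    field_simp
  rw [h, one_pow, one_mul]

/-- If `f(x, p) = e^(i⟨x, Γ(p)⟩) β(p)`, then pairing the partial Fourier transform of `f` with `φ ⊗ u`
amounts to evaluating the inverse Fourier transform of `φ` along `Γ`. -/
theorem integral_phase_tensor (κ : ℝ) {f : E → F → ℂ} {Γ : F → E} {β : F → ℂ}
    (hf : ∀ᵐ z : E × F, f z.1 z.2 = Complex.exp (Complex.I * (inner ℝ z.1 (Γ z.2) : ℝ)) * β z.2)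
    (φ : 𝓢(E, ℂ)) (u : 𝓢(F, ℂ))
    (hint : Integrable (fun z : E × F =>
      f z.1 z.2 * fourierInt κ (fun ξ' => schwartzTensor φ u (z.1, ξ')) z.2)) :
    ∫ z : E × F, f z.1 z.2 * fourierInt κ (fun ξ' => schwartzTensor φ u (z.1, ξ')) z.2 =
      (κ : ℂ) ^ Module.finrank ℝ F * ∫ p, β p * 𝓕⁻ φ ((2 * Real.pi)⁻¹ • Γ p) *
        𝓕 u ((2 * Real.pi)⁻¹ • p) := by
  have hae : (fun z : E × F =>
      f z.1 z.2 * fourierInt κ (fun ξ' => schwartzTensor φ u (z.1, ξ')) z.2) =ᵐ[volume]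
      fun z => (Complex.exp (Complex.I * (inner ℝ z.1 (Γ z.2) : ℝ)) * φ z.1) *
        ((κ : ℂ) ^ Module.finrank ℝ F * (β z.2 * 𝓕 u ((2 * Real.pi)⁻¹ • z.2))) := by
    filter_upwards [hf] with z hz
    simp only [schwartzTensor_apply]
    rw [fourierInt_const_mul, fourierInt_schwartz, hz]
    ring
  rw [integral_congr_ae hae, Measure.volume_eq_prod, integral_prod_symm _ (hint.congr hae),
    ← integral_const_mul]
  refine integral_congr_ae (Filter.Eventually.of_forall fun p => ?_)
  dsimp only
  rw [integral_mul_const, integral_exp_inner_mul]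
  ring

end General

variable {d : ℕ}

/-- The substitution `q ↦ 2π q`, which passes from the kernel `e^(-ixp)` to `e^(-2πi xξ)`. -/
theorem mul_integral_eq_of_dilate (κ : ℝ) {f g : SpaceM d → ℂ}
    (h : ∀ q, f ((2 * Real.pi) • q) = g q) :
    (κ : ℂ) ^ (2 * d) * ∫ q, f q = ((2 * Real.pi * κ : ℝ) : ℂ) ^ (2 * d) * ∫ q, g q := by
  have h1 := Measure.integral_comp_smul_of_nonneg volume f (2 * Real.pi) (hR := by positivity)
  have h2 : ((2 * Real.pi : ℝ) : ℂ) ^ (2 * d) ≠ 0 :=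
    pow_ne_zero _ (by exact_mod_cast (by positivity : (2 * Real.pi : ℝ) ≠ 0))
  simp only [h] at h1
  rw [h1, Complex.real_smul, finrank_euclideanSpace, Fintype.card_sum, Fintype.card_fin, ← two_mul,
    Complex.ofReal_mul, mul_pow, Complex.ofReal_inv, Complex.ofReal_pow]
  field_simp

/-- Decay of the amplitude in the fiber variable `τ'` and of the test function in `p'` make the
kernel of the trace absolutely convergent. -/
theorem integrable_phase_fstM {m : ℝ} (hm : m < -d) {G : SpaceM d → SpaceM d} (hG : Measurable G)
    {b : SpaceM d → ℂ} (hb : Measurable b) {C : ℝ} (hC : 0 ≤ C)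
    (hbτ : ∀ p τ, ‖b (mkM p τ)‖ ≤ C * bracket m τ) (φ v : 𝓢(SpaceX d, ℂ)) :
    Integrable fun q : SpaceM d => b q * 𝓕⁻ φ ((2 * Real.pi)⁻¹ • fstM (G q)) *
      𝓕 v ((2 * Real.pi)⁻¹ • fstM q) := by
  rw [← integrable_mkM_iff]
  have hmk : Measurable fun z : SpaceX d × SpaceX d => mkM z.1 z.2 := continuous_mkM.measurable
  have hfst : Measurable (fstM : SpaceM d → SpaceX d) := continuous_fstM.measurable
  obtain ⟨M, hM⟩ : ∃ M, ∀ ξ, ‖𝓕⁻ φ ξ‖ ≤ M := by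
    obtain ⟨M, hM⟩ := (𝓕⁻ φ).decay' 0 0
    refine ⟨M, fun ξ => ?_⟩
    have := hM ξ
    rwa [pow_zero, one_mul, norm_iteratedFDeriv_zero] at this
  have hv : Integrable fun p : SpaceX d => 𝓕 v ((2 * Real.pi)⁻¹ • p) := (dilate (𝓕 v)).integrable
  have hdom := (hv.norm.const_mul M).mul_prod ((integrable_bracket d hm).const_mul C)
  refine hdom.mono' ?_ (Filter.Eventually.of_forall fun z => ?_)
  · have h1 := (𝓕⁻ φ).continuous.measurable
    have h2 := (𝓕 v).continuous.measurable
    refine Measurable.aestronglyMeasurable ?_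
    fun_prop
  · rw [norm_mul, norm_mul, fstM_mkM]
    calc ‖b (mkM z.1 z.2)‖ * ‖𝓕⁻ φ ((2 * Real.pi)⁻¹ • fstM (G (mkM z.1 z.2)))‖ *
          ‖𝓕 v ((2 * Real.pi)⁻¹ • z.1)‖
        ≤ (C * bracket m z.2) * M * ‖𝓕 v ((2 * Real.pi)⁻¹ • z.1)‖ := by
          gcongr
          · exact mul_nonneg hC (bracket_pos _ _).le
          · exact hbτ _ _
          · exact hM _
      _ = _ := by ring

end Kernels

/-! ### Uniqueness of the trace -/

section Uniqueness

variable {d : ℕ}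

theorem IsCoboundaryOperator.unique {r r' : ℝ}
    {J J' : SobolevSpace (SpaceX d) r →L[ℂ] SobolevSpace (SpaceM d) r'}
    (h : IsCoboundaryOperator J) (h' : IsCoboundaryOperator J') : J = J' :=
  ContinuousLinearMap.ext fun v => SobolevSpace.toDistr_injective ((h v).trans (h' v).symm)

theorem IsBoundaryOperator.unique {r r' : ℝ}
    {R R' : SobolevSpace (SpaceM d) r →L[ℂ] SobolevSpace (SpaceX d) r'}
    (h : IsBoundaryOperator R) (h' : IsBoundaryOperator R') : R = R' :=
  ContinuousLinearMap.coeFn_injective <|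
    (SobolevSpace.denseRange_ofSchwartz r).equalizer R.continuous R'.continuous <|
      funext fun u => (h u).trans (h' u).symm

theorem hasSchwartzKernel_unique {r r' : ℝ} {K : 𝓢'(SpaceM d × SpaceM d, ℂ)}
    {A A' : SobolevSpace (SpaceM d) r →L[ℂ] SobolevSpace (SpaceM d) r'}
    (h : HasSchwartzKernel (fun u => (A (.ofSchwartz _ u)).toDistr) K)
    (h' : HasSchwartzKernel (fun u => (A' (.ofSchwartz _ u)).toDistr) K) : A = A' :=
  ContinuousLinearMap.coeFn_injective <|
    (SobolevSpace.denseRange_ofSchwartz r).equalizer A.continuous A'.continuous <|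
      funext fun u => SobolevSpace.toDistr_injective <| by
        ext φ
        exact (h u φ).trans (h' u φ).symm

theorem IsTrace.unique {K : 𝓢'(SpaceM d × SpaceM d, ℂ)} {m s : ℝ}
    {T T' : SobolevSpace (SpaceX d) s →L[ℂ] SobolevSpace (SpaceX d) (s - m - d)}
    (h : IsTrace K m s T) (h' : IsTrace K m s T') : T = T' := by
  obtain ⟨J, A, R, hJ, hA, hR, rfl⟩ := h
  obtain ⟨J', A', R', hJ', hA', hR', rfl⟩ := h'
  rw [hJ.unique hJ', hasSchwartzKernel_unique hA hA', hR.unique hR']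

end Uniqueness

/-! ### The trace of an operator with a phase linear in `y` -/

section Phase

variable {d : ℕ}

set_option maxHeartbeats 1000000 in
/-- The kernels of the trace of the operator with symbol `f(y, q') = e^(i⟨y, G(q')⟩) b(q')`. At
`q' = 0` the phase may depend on `y` in any way, even a non-measurable one; this is a null set, for
the restricted symbols because `d > 0`. -/
theorem trace_of_phase (hd : 0 < d) {κ : ℝ} (hκ : 0 < κ) {m s : ℝ}
    (hs : s < 0) (hsm : 0 < s - m - d) {f : SpaceM d → SpaceM d → ℂ} {G : SpaceM d → SpaceM d}
    {b : SpaceM d → ℂ} (hG : IsPhaseMap G) (hb : Measurable b)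
    (hbm : ∃ C, ∀ q, ‖b q‖ ≤ C * bracket m q)
    (hf : ∀ y q, q ≠ 0 → f y q = Complex.exp (Complex.I * (inner ℝ y (G q) : ℝ)) * b q)
    (hfb : ∀ y q, ‖f y q‖ = ‖b q‖) :
    ∃ KΦ : 𝓢'(SpaceM d × SpaceM d, ℂ),
      IsFourierInSnd κ f KΦ ∧
      (∃! T, IsTrace KΦ m s T) ∧
      ∃ (D D' : SpaceX d → 𝓢'(SpaceX d × SpaceX d, ℂ)) (K K' : 𝓢'(SpaceX d × SpaceX d, ℂ)),
        (∀ τ', IsFourierInSnd κ (fun x p' => f (mkM x 0) (mkM p' τ')) (D τ')) ∧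
        IsDistrIntegral D K ∧
        (∀ τ', IsFourierInFst κ (fun x p' => f (mkM x 0) (mkM p' τ')) (D' τ')) ∧
        IsDistrIntegral D' K' ∧
        ∀ T, IsTrace KΦ m s T →
          HasSchwartzKernel (fun v => (T (.ofSchwartz s v)).toDistr) ((κ : ℂ) ^ d • K) ∧
          HasSchwartzKernel (dualOperator κ T) ((κ : ℂ) ^ d • K') := by
  have hd0 : (0 : ℝ) ≤ d := Nat.cast_nonneg d
  have hmd : m < -d := by linarith
  have hm : m ≤ 0 := by linarith
  have : Nonempty (Fin d) := ⟨⟨0, hd⟩⟩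
  have hπ : (2 * Real.pi)⁻¹ * (2 * Real.pi) = 1 := inv_mul_cancel₀ (by positivity)
  have hl : ∀ q : SpaceM d, fstM ((2 * Real.pi) • q) = (2 * Real.pi) • fstM q := fun q => rfl
  have hGm := hG.measurable
  have hmk : Measurable fun z : SpaceX d × SpaceX d => mkM z.1 z.2 := continuous_mkM.measurable
  have hfst : Measurable (fstM : SpaceM d → SpaceX d) := continuous_fstM.measurable
  obtain ⟨C, hC⟩ := hbm
  have hC0 : 0 ≤ C := nonneg_of_mul_nonneg_left ((norm_nonneg _).trans (hC 0)) (bracket_pos m 0)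
  have hbC : ∀ q, ‖b q‖ ≤ C := fun q =>
    (hC q).trans (mul_le_of_le_one_right hC0 (bracket_le_one hm q))
  have hbτ : ∀ p τ, ‖b (mkM p τ)‖ ≤ C * bracket m τ := fun p τ =>
    (hC _).trans (mul_le_mul_of_nonneg_left
      (bracket_le_of_norm_le hm (norm_snd_le_norm_mkM p τ)) hC0)
  -- the symbol is only known off the null set `q' = 0`
  have haeM : ∀ᵐ z : SpaceM d × SpaceM d,
      f z.1 z.2 = Complex.exp (Complex.I * (inner ℝ z.1 (G z.2) : ℝ)) * b z.2 := by
    have h0 : ∀ᵐ q : SpaceM d, q ≠ 0 := Measure.ae_ne volume 0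
    filter_upwards [Measure.quasiMeasurePreserving_snd.ae h0] with z hz using hf _ _ hz
  have h0X : ∀ᵐ p : SpaceX d, p ≠ 0 := Measure.ae_ne volume 0
  have hfX : ∀ (x p τ : SpaceX d), p ≠ 0 → f (mkM x 0) (mkM p τ) =
      Complex.exp (Complex.I * (inner ℝ x (fstM (G (mkM p τ))) : ℝ)) * b (mkM p τ) := by
    intro x p τ hp
    rw [hf _ _ (mkM_ne_zero hp τ), inner_mkM_zero]
  have haeX : ∀ τ, ∀ᵐ z : SpaceX d × SpaceX d, f (mkM z.1 0) (mkM z.2 τ) =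
      Complex.exp (Complex.I * (inner ℝ z.1 (fstM (G (mkM z.2 τ))) : ℝ)) * b (mkM z.2 τ) := by
    intro τ
    filter_upwards [Measure.quasiMeasurePreserving_snd.ae h0X] with z hz using hfX _ _ _ hz
  have haeT : ∀ᵐ w : SpaceX d × (SpaceX d × SpaceX d), f (mkM w.2.1 0) (mkM w.2.2 w.1) =
      Complex.exp (Complex.I * (inner ℝ w.2.1 (fstM (G (mkM w.2.2 w.1))) : ℝ)) *
        b (mkM w.2.2 w.1) := by
    filter_upwards [Measure.quasiMeasurePreserving_snd.ae
      (Measure.quasiMeasurePreserving_snd.ae h0X)] with w hw using hfX _ _ _ hw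
  have hmeasM : AEStronglyMeasurable (fun z : SpaceM d × SpaceM d => f z.1 z.2) volume := by
    refine AEMeasurable.aestronglyMeasurable (AEMeasurable.congr (Measurable.aemeasurable ?_)
      (Filter.EventuallyEq.symm haeM))
    fun_prop
  have hmeasX : ∀ τ, AEStronglyMeasurable
      (fun z : SpaceX d × SpaceX d => f (mkM z.1 0) (mkM z.2 τ)) volume := by
    intro τ
    refine AEMeasurable.aestronglyMeasurable (AEMeasurable.congr (Measurable.aemeasurable ?_)
      (Filter.EventuallyEq.symm (haeX τ)))
    have h1 : Measurable fun z : SpaceX d × SpaceX d => mkM z.2 τ :=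
      hmk.comp (measurable_snd.prodMk measurable_const)
    fun_prop
  have hmeasT : AEStronglyMeasurable (fun w : SpaceX d × (SpaceX d × SpaceX d) =>
      f (mkM w.2.1 0) (mkM w.2.2 w.1)) volume := by
    refine AEMeasurable.aestronglyMeasurable (AEMeasurable.congr (Measurable.aemeasurable ?_)
      (Filter.EventuallyEq.symm haeT))
    have h1 : Measurable fun w : SpaceX d × (SpaceX d × SpaceX d) => mkM w.2.2 w.1 :=
      hmk.comp ((measurable_snd.comp measurable_snd).prodMk measurable_fst)
    fun_prop
  have hBi : Integrable (fun τ : SpaceX d => C * bracket m τ) :=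
    (integrable_bracket d hmd).const_mul C
  obtain ⟨KΦ, hKΦ⟩ := exists_isFourierInSnd κ hmeasM (B := C) (fun y q => by rw [hfb]; exact hbC q)
  obtain ⟨D, K, hD, hK⟩ := (isIntegrableTransform_fourierSnd (E := SpaceX d) (F := SpaceX d)
    κ).exists_distr_integral (f := fun τ z => f (mkM z.1 0) (mkM z.2 τ)) hmeasX hmeasT
    (fun τ z => by rw [hfb]; exact hbτ _ _) hBi
  obtain ⟨D', K', hD', hK'⟩ := (isIntegrableTransform_fourierFst (E := SpaceX d) (F := SpaceX d)
    κ).exists_distr_integral (f := fun τ z => f (mkM z.1 0) (mkM z.2 τ)) hmeasX hmeasT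
    (fun τ z => by rw [hfb]; exact hbτ _ _) hBi
  obtain ⟨BJ, hBJ⟩ := exists_coboundary_L2 d hs
  -- the boundary operator maps to `H^(s - m - d)`, whence the exponent `-(s - m - d) < 0`
  obtain ⟨BR, hBR⟩ := exists_coboundary_L2 d (σ := -(s - m - d)) (by linarith)
  obtain ⟨BA, hBA⟩ := exists_phase_L2 κ hm hG hb ⟨C, hC⟩ (r := s - d / 2) (r' := s - d / 2 - m) rfl
  obtain ⟨J, hJ, hJ'⟩ := exists_isCoboundaryOperator d (ρ := s - d / 2) rfl hBJ
  obtain ⟨R, hR, hR'⟩ := exists_isBoundaryOperator d (ρ := s - d / 2 - m) (r := s - m - d)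
    (by ring) (by ring) hBR
  obtain ⟨A, hA, hA'⟩ := exists_quantized_operator κ hG hBA
  have hAK : HasSchwartzKernel (fun u => (A (.ofSchwartz _ u)).toDistr) KΦ := by
    intro u φ
    dsimp only
    obtain ⟨h1, h2⟩ := hKΦ (schwartzTensor φ u)
    rw [hA', h2, integral_phase_tensor κ haeM φ u h1, finrank_euclideanSpace,
      Fintype.card_sum, Fintype.card_fin, ← two_mul]
    refine (mul_integral_eq_of_dilate κ fun q => ?_).symm
    rw [hG.homogeneous _ _ (by positivity), smul_smul, smul_smul, hπ, one_smul, one_smul]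
  have hT : IsTrace KΦ m s (R ∘L A ∘L J) := ⟨J, A, R, hJ, hAK, hR, rfl⟩
  have hTK : HasSchwartzKernel (fun v => ((R ∘L A ∘L J) (.ofSchwartz s v)).toDistr)
      ((κ : ℂ) ^ d • K) := by
    intro v φ
    have hint := integrable_phase_fstM hmd hGm hb hC0 hbτ φ v
    have hDτ : ∀ τ, D τ (schwartzTensor φ v) = (κ : ℂ) ^ d * ∫ p : SpaceX d, b (mkM p τ) *
        𝓕⁻ φ ((2 * Real.pi)⁻¹ • fstM (G (mkM p τ))) *
          𝓕 v ((2 * Real.pi)⁻¹ • p) := by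
      intro τ
      obtain ⟨h1, h2⟩ := hD τ (schwartzTensor φ v)
      rw [h2]
      refine (integral_phase_tensor κ (f := fun x p => f (mkM x 0) (mkM p τ))
        (Γ := fun p => fstM (G (mkM p τ))) (β := fun p => b (mkM p τ)) (haeX τ) φ v h1).trans ?_
      rw [finrank_euclideanSpace_fin]
    have h3 : ∫ τ : SpaceX d, ∫ p : SpaceX d, b (mkM p τ) *
        𝓕⁻ φ ((2 * Real.pi)⁻¹ • fstM (G (mkM p τ))) * 𝓕 v ((2 * Real.pi)⁻¹ • p) =
        ∫ q : SpaceM d, b q * 𝓕⁻ φ ((2 * Real.pi)⁻¹ • fstM (G q)) *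
          𝓕 v ((2 * Real.pi)⁻¹ • fstM q) := by
      rw [← integral_mkM, Measure.volume_eq_prod,
        integral_prod_symm _ (by exact integrable_mkM_iff.mpr hint)]
      rfl
    have h4 : ((κ : ℂ) ^ d • K) (schwartzTensor φ v) = (κ : ℂ) ^ d * K (schwartzTensor φ v) := rfl
    rw [h4, (hK (schwartzTensor φ v)).2]
    simp only [hDτ]
    rw [integral_const_mul, h3, ← mul_assoc, ← pow_add, ← two_mul]
    refine (trace_apply_schwartz κ hG rfl (by ring) hBA hBJ hBR hJ' hA hR' v φ).trans ?_
    refine (mul_integral_eq_of_dilate κ fun q => ?_).symm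
    rw [hG.homogeneous _ _ (by positivity), hl, hl, smul_smul, smul_smul, hπ, one_smul, one_smul]
  refine ⟨KΦ, hKΦ, ⟨_, hT, fun T' hT' => hT'.unique hT⟩, D, D', K, K', hD, hK, hD', hK', ?_⟩
  intro T hT'
  rw [hT'.unique hT]
  refine ⟨hTK, fun u φ => ?_⟩
  -- conjugation by the Fourier transform moves it from the second variable to the first
  have h5 := hTK (fourierInvS κ u) (fourierS κ φ)
  refine h5.trans ?_
  change (κ : ℂ) ^ d * K _ = (κ : ℂ) ^ d * K' _
  rw [(hK _).2, (hK' _).2]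
  congr 1
  refine integral_congr_ae (Filter.Eventually.of_forall fun τ => ?_)
  dsimp only
  rw [(hD τ _).2, (hD' τ _).2]
  refine integral_congr_ae (Filter.Eventually.of_forall fun z => ?_)
  simp only [schwartzTensor_apply]
  rw [fourierInt_const_mul, fourierInt_mul_const, ← fourierS_apply, ← fourierS_apply,
    fourierS_fourierInvS hκ]

end Phase

/-! ### Homogeneous maps -/

section Homogeneous

variable {E : Type} [NormedAddCommGroup E] [NormedSpace ℝ E]

theorem exists_bound_of_homogeneous_zero [FiniteDimensional ℝ E] {F : Type}
    [NormedAddCommGroup F] {f : E → F} (hf : ContinuousOn f {q | q ≠ 0})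
    (hh : ∀ (q : E) (c : ℝ), q ≠ 0 → 0 < c → f (c • q) = f q) :
    ∃ C : ℝ, 0 < C ∧ ∀ q, q ≠ 0 → ‖f q‖ ≤ C := by
  obtain ⟨C, hC⟩ := (isCompact_sphere (0 : E) 1).exists_bound_of_continuousOn
    (hf.mono fun q hq => ne_zero_of_mem_unit_sphere ⟨q, hq⟩)
  refine ⟨max C 1, by positivity, fun q hq => ?_⟩
  have hq' : 0 < ‖q‖ := norm_pos_iff.mpr hq
  rw [← hh q ‖q‖⁻¹ hq (by positivity)]
  refine (hC _ ?_).trans (le_max_left _ _)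
  rw [mem_sphere_zero_iff_norm, norm_smul, norm_inv, norm_norm, inv_mul_cancel₀ hq'.ne']

variable {F : Type} [NormedAddCommGroup F] [NormedSpace ℝ F]

theorem exists_bound_of_homogeneous_one [FiniteDimensional ℝ E] {f : E → F} (hf : ContinuousOn f {q | q ≠ 0})
    (hh : ∀ (q : E) (c : ℝ), q ≠ 0 → 0 < c → f (c • q) = c • f q) :
    ∃ C : ℝ, 0 < C ∧ ∀ q, q ≠ 0 → ‖f q‖ ≤ C * ‖q‖ := by
  obtain ⟨C, hC0, hC⟩ := exists_bound_of_homogeneous_zero (f := fun q => ‖q‖⁻¹ • f q)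
    (ContinuousOn.smul (continuous_norm.continuousOn.inv₀ fun q hq => norm_ne_zero_iff.mpr hq) hf)
    (fun q c hq hc => by
      rw [hh q c hq hc, norm_smul, Real.norm_of_nonneg hc.le, smul_smul]
      congr 1
      field_simp)
  refine ⟨C, hC0, fun q hq => ?_⟩
  have h := hC q hq
  rwa [norm_smul, norm_inv, norm_norm, inv_mul_le_iff₀ (norm_pos_iff.mpr hq), mul_comm] at h

theorem fderiv_smul_of_homogeneous_one {f : E → F}
    (hh : ∀ (q : E) (c : ℝ), q ≠ 0 → 0 < c → f (c • q) = c • f q) {q : E} (hq : q ≠ 0) {c : ℝ}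
    (hc : 0 < c) : fderiv ℝ f (c • q) = fderiv ℝ f q := by
  have h1 : (fun x => f (c • x)) =ᶠ[nhds q] fun x => c • f x := by
    filter_upwards [isOpen_ne.mem_nhds hq] with x hx using hh x c hx hc
  have h2 := h1.fderiv_eq (𝕜 := ℝ)
  rw [fderiv_comp_smul, show (fun x => c • f x) = c • f from rfl,
    fderiv_const_smul_field] at h2
  exact smul_right_injective (E →L[ℝ] F) hc.ne' h2

/-- The preimage measure of a homogeneous map of degree `1` with a smooth homogeneous inverse `H` is
controlled by the Jacobian of `H`, which is bounded, being homogeneous of degree `0`. -/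
theorem exists_map_le_of_homogeneous_inverse [FiniteDimensional ℝ E] [MeasurableSpace E]
    [BorelSpace E] (ν : Measure E) [ν.IsAddHaarMeasure] [NullSingletonClass ν] {f H : E → E} (hf : Measurable f)
    (hf0 : ∀ q, q ≠ 0 → f q ≠ 0) (hH : ContDiffOn ℝ ∞ H {q | q ≠ 0})
    (hh : ∀ (q : E) (c : ℝ), q ≠ 0 → 0 < c → H (c • q) = c • H q)
    (hinv : ∀ q, q ≠ 0 → H (f q) = q) : ∃ C : NNReal, Measure.map f ν ≤ C • ν := by
  have hopen : IsOpen {q : E | q ≠ 0} := isOpen_ne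
  have hcont : ContinuousOn (fun q => (fderiv ℝ H q).det) {q | q ≠ 0} :=
    ContinuousLinearMap.continuous_det.comp_continuousOn
      (hH.continuousOn_fderiv_of_isOpen hopen (by simp))
  obtain ⟨C, hC0, hC⟩ := exists_bound_of_homogeneous_zero hcont fun q c hq hc => by
    rw [fderiv_smul_of_homogeneous_one hh hq hc]
  refine ⟨C.toNNReal, Measure.le_iff.mpr fun B hB => ?_⟩
  rw [Measure.map_apply hf hB]
  have hB' : MeasurableSet (B \ {0}) := hB.diff (measurableSet_singleton 0)
  have hsub : f ⁻¹' B ⊆ {0} ∪ H '' (B \ {0}) := by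
    intro q hq
    by_cases h0 : q = 0
    · exact Or.inl h0
    · exact Or.inr ⟨f q, ⟨hq, hf0 q h0⟩, hinv q h0⟩
  calc ν (f ⁻¹' B) ≤ ν ({0} ∪ H '' (B \ {0})) := measure_mono hsub
    _ ≤ ν {0} + ν (H '' (B \ {0})) := measure_union_le _ _
    _ = ν (H '' (B \ {0})) := by rw [measure_singleton, zero_add]
    _ ≤ ∫⁻ q in B \ {0}, ENNReal.ofReal |(fderiv ℝ H q).det| ∂ν := by
        refine addHaar_image_le_lintegral_abs_det_fderiv ν hB' fun q hq => ?_
        exact (((hH.contDiffAt (hopen.mem_nhds hq.2)).differentiableAt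
          (by simp)).hasFDerivAt).hasFDerivWithinAt
    _ ≤ ∫⁻ q in B \ {0}, ENNReal.ofReal C ∂ν := by
        refine setLIntegral_mono measurable_const fun q hq => ?_
        exact ENNReal.ofReal_le_ofReal (hC q hq.2)
    _ = ENNReal.ofReal C * ν (B \ {0}) := setLIntegral_const _ _
    _ ≤ ENNReal.ofReal C * ν B := by gcongr; exact Set.sdiff_subset
    _ = (C.toNNReal • ν) B := rfl

end Homogeneous

/-! ### The fiber map of the canonical transformation -/

section Geometry

variable {d : ℕ} {g : SpaceM d × SpaceM d → SpaceM d × SpaceM d} {S : SpaceM d → SpaceM d → ℝ}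
  {μ : SpaceM d → ℝ} {a : SpaceM d → ℂ} {m : ℝ}

/-- The covector component of the map induced by `g` on the fiber over `x₀ = 0`, extended by `0`. -/
noncomputable def fiberMap (g : SpaceM d × SpaceM d → SpaceM d × SpaceM d) (q : SpaceM d) :
    SpaceM d :=
  open scoped Classical in if q = 0 then 0 else (g (0, q)).2

theorem fiberMap_of_ne (g : SpaceM d × SpaceM d → SpaceM d × SpaceM d) {q : SpaceM d}
    (hq : q ≠ 0) : fiberMap g q = (g (0, q)).2 := if_neg hq

theorem ConditionA.apply_zero (hA : ConditionA g) {q : SpaceM d} (hq : q ≠ 0) :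
    g (0, q) = (0, fiberMap g q) ∧ fiberMap g q ≠ 0 := by
  have h : g (0, q) ∈ {w : SpaceM d × SpaceM d | w.1 = 0 ∧ w.2 ≠ 0} := by
    rw [← hA.fiber]
    exact ⟨(0, q), ⟨rfl, hq⟩, rfl⟩
  rw [fiberMap_of_ne g hq]
  exact ⟨Prod.ext h.1 rfl, h.2⟩

/-- By Euler's identity the generating function vanishes at `y = 0`, so it is the linear function
given by the fiber map. -/
theorem IsQuantizationData.generating_eq (h : IsQuantizationData g S μ a m) (y : SpaceM d)
    {q : SpaceM d} (hq : q ≠ 0) : S y q = inner ℝ y (fiberMap g q) := by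
  obtain ⟨h1, h2⟩ := (h.generating.graph 0 (fiberMap g q) 0 q hq).mp
    (h.condA.apply_zero hq).1
  obtain ⟨c, L, hL⟩ := h.linear q hq
  have hopen : IsOpen (cotangentM d) := isOpen_ne.preimage continuous_snd
  have hdiff : DifferentiableAt ℝ (fun ξ => S 0 ξ) q := by
    have h3 : DifferentiableAt ℝ (fun w : SpaceM d × SpaceM d => S w.1 w.2) ((0 : SpaceM d), q) :=
      (h.generating.smooth.contDiffAt (hopen.mem_nhds hq)).differentiableAt (by simp)
    exact h3.comp q (f := fun ξ : SpaceM d => ((0 : SpaceM d), ξ))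
      ((differentiableAt_const _).prodMk differentiableAt_id)
  have hS0 : S 0 q = 0 := by
    have e1 : HasDerivAt (fun t : ℝ => S 0 (t • q)) (fderiv ℝ (fun ξ => S 0 ξ) q q) 1 := by
      have h4 : HasDerivAt (fun t : ℝ => t • q) q 1 := by
        simpa using (hasDerivAt_id (1 : ℝ)).smul_const q
      have h5 : HasFDerivAt (fun ξ => S 0 ξ) (fderiv ℝ (fun ξ => S 0 ξ) q) ((1 : ℝ) • q) := by
        rw [one_smul]; exact hdiff.hasFDerivAt
      exact h5.comp_hasDerivAt (1 : ℝ) h4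
    have e2 : HasDerivAt (fun t : ℝ => S 0 (t • q)) (S 0 q) 1 := by
      have h6 : HasDerivAt (fun t : ℝ => t * S 0 q) (S 0 q) 1 := by
        simpa using (hasDerivAt_id (1 : ℝ)).mul_const (S 0 q)
      refine h6.congr_of_eventuallyEq ?_
      filter_upwards [lt_mem_nhds (zero_lt_one (α := ℝ))] with t ht
      exact h.generating.homogeneous 0 q t hq ht
    rw [e2.unique e1, ← inner_gradient_left, ← h2, inner_zero_left]
  have hc : c = 0 := by
    have := hL 0
    rw [hS0, map_zero, add_zero] at this
    exact this.symm
  have hfun : (fun z => S z q) = fun z => LinearMap.toContinuousLinearMap L z := by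
    ext z
    rw [hL z, hc, zero_add]; rfl
  rw [real_inner_comm, h1, inner_gradient_left, hfun, ContinuousLinearMap.fderiv, hL y, hc, zero_add]
  rfl

/-- The inverse of the fiber map is smooth off `0`, being induced by the inverse of `g`. -/
theorem IsQuantizationData.isPhaseMap (h : IsQuantizationData g S μ a m) (hd : 0 < d) :
    IsPhaseMap (fiberMap g) := by
  have : Nonempty (Fin d ⊕ Fin d) := ⟨Sum.inl ⟨0, hd⟩⟩
  obtain ⟨hg, -, g', hg', -, hinv⟩ := h.canonical.diffeo
  have hsec : ContDiff ℝ ∞ fun q : SpaceM d => ((0 : SpaceM d), q) :=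
    contDiff_const.prodMk contDiff_id
  have hcont : ContinuousOn (fiberMap g) {q | q ≠ 0} := by
    have h1 : ContinuousOn (fun q : SpaceM d => (g (0, q)).2) {q | q ≠ 0} :=
      continuous_snd.comp_continuousOn (hg.continuousOn.comp hsec.continuous.continuousOn
        fun q hq => hq)
    exact h1.congr fun q hq => fiberMap_of_ne g hq
  have hhom : ∀ (q : SpaceM d) (c : ℝ), q ≠ 0 → 0 < c → fiberMap g (c • q) = c • fiberMap g q := by
    intro q c hq hc
    rw [fiberMap_of_ne g hq, fiberMap_of_ne g (smul_ne_zero hc.ne' hq),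
      h.canonical.homogeneous 0 q c hq hc]
  set H : SpaceM d → SpaceM d := fun q => (g' (0, q)).2 with hH
  have hHG : ∀ q, q ≠ 0 → H (fiberMap g q) = q := by
    intro q hq
    have h1 : g' (g (0, q)) = (0, q) := hinv.1 (show ((0 : SpaceM d), q) ∈ cotangentM d from hq)
    rw [(h.condA.apply_zero hq).1] at h1
    rw [hH]; exact congrArg Prod.snd h1
  have hsurj : ∀ q, q ≠ 0 → ∃ p, p ≠ 0 ∧ fiberMap g p = q := by
    intro q hq
    have h1 : ((0 : SpaceM d), q) ∈ g '' {w | w.1 = 0 ∧ w.2 ≠ 0} := by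
      rw [h.condA.fiber]; exact ⟨rfl, hq⟩
    obtain ⟨⟨y, p⟩, ⟨hy, hp⟩, hgp⟩ := h1
    dsimp only at hy hp
    subst hy
    exact ⟨p, hp, by rw [fiberMap_of_ne g hp, hgp]⟩
  have hHhom : ∀ (q : SpaceM d) (c : ℝ), q ≠ 0 → 0 < c → H (c • q) = c • H q := by
    intro q c hq hc
    obtain ⟨p, hp, rfl⟩ := hsurj q hq
    rw [← hhom p c hp hc, hHG p hp, hHG _ (smul_ne_zero hc.ne' hp)]
  have hHsm : ContDiffOn ℝ ∞ H {q | q ≠ 0} :=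
    contDiff_snd.comp_contDiffOn (hg'.comp hsec.contDiffOn fun q hq => hq)
  have hzero : fiberMap g 0 = 0 := if_pos rfl
  refine ⟨measurable_of_continuousOn_compl_singleton 0 hcont, fun q c hc => ?_, ?_, ?_,
    exists_map_le_of_homogeneous_inverse volume (measurable_of_continuousOn_compl_singleton 0 hcont)
      (fun q hq => (h.condA.apply_zero hq).2) hHsm hHhom hHG⟩
  · by_cases hq : q = 0
    · rw [hq, smul_zero, hzero, smul_zero]
    · exact hhom q c hq hc
  · obtain ⟨C, hC0, hC⟩ := exists_bound_of_homogeneous_one hcont hhom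
    refine ⟨C, hC0, fun q => ?_⟩
    by_cases hq : q = 0
    · rw [hq, hzero]; simp
    · exact hC q hq
  · obtain ⟨C, hC0, hC⟩ := exists_bound_of_homogeneous_one hHsm.continuousOn hHhom
    refine ⟨C⁻¹, by positivity, fun q => ?_⟩
    by_cases hq : q = 0
    · rw [hq]; simp
    · rw [inv_mul_le_iff₀ hC0]
      have h1 := hC _ (h.condA.apply_zero hq).2
      rwa [hHG q hq] at h1

/-- As `m ≤ 0`, homogeneity for large `q` bounds the amplitude by `⟨q⟩^m` everywhere. -/
theorem IsQuantizationData.exists_amplitude_le (h : IsQuantizationData g S μ a m) (hm : m ≤ 0) :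
    ∃ C, ∀ q, ‖((Real.sqrt (μ q) : ℝ) : ℂ) * a q‖ ≤ C * bracket m q := by
  obtain ⟨C₁, hC₁0, hC₁⟩ := exists_bound_of_homogeneous_zero h.density_smooth.continuousOn
    h.density_homogeneous
  set N := max (Real.sqrt C₁) (Real.sqrt (μ 0)) with hN
  have hμ : ∀ q, Real.sqrt (μ q) ≤ N := by
    intro q
    by_cases hq : q = 0
    · rw [hq]; exact le_max_right _ _
    · exact (Real.sqrt_le_sqrt ((le_abs_self _).trans (hC₁ q hq))).trans (le_max_left _ _)
  have hN0 : 0 ≤ N := (Real.sqrt_nonneg _).trans (hμ 0)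
  obtain ⟨ρ, hρ0, hρ⟩ := h.amplitude_homogeneous
  obtain ⟨M, hM⟩ := (isCompact_closedBall (0 : SpaceM d) ρ).exists_bound_of_continuousOn
    h.amplitude_smooth.continuous.continuousOn
  have hM0 : 0 ≤ M := (norm_nonneg _).trans (hM 0 (by simp [hρ0.le]))
  have hbr : ∀ q : SpaceM d, bracket m q = (bracket 1 q) ^ m := by
    intro q
    unfold bracket
    rw [← Real.rpow_mul (by positivity)]
    congr 1; ring
  have hb1 : ∀ q : SpaceM d, bracket 1 q ≤ 1 + ‖q‖ := by
    intro q
    unfold bracket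
    rw [← Real.sqrt_eq_rpow]
    exact Real.sqrt_le_iff.mpr ⟨by positivity, by nlinarith [norm_nonneg q]⟩
  have ha : ∀ q, ‖a q‖ ≤ M * (1 + ρ) ^ (-m) * bracket m q := by
    intro q
    have hb0 := bracket_pos 1 q
    rw [mul_assoc, hbr, Real.rpow_neg (by positivity), ← Real.inv_rpow (by positivity),
      ← Real.mul_rpow (by positivity) hb0.le]
    rcases le_or_gt ‖q‖ ρ with hq | hq
    · refine (hM q (by simpa using hq)).trans (le_mul_of_one_le_right hM0 ?_)
      refine Real.one_le_rpow_of_pos_of_le_one_of_nonpos (by positivity) ?_ hm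
      rw [inv_mul_le_iff₀ (by positivity), mul_one]
      exact (hb1 q).trans (by linarith)
    · have hq0 : 0 < ‖q‖ := hρ0.trans hq
      have hc : 1 ≤ ‖q‖ / ρ := (one_le_div hρ0).mpr hq.le
      have hn : ‖(ρ / ‖q‖) • q‖ = ρ := by
        rw [norm_smul, Real.norm_of_nonneg (by positivity), div_mul_cancel₀ _ hq0.ne']
      have hs : (‖q‖ / ρ) • ((ρ / ‖q‖) • q) = q := by
        rw [smul_smul, div_mul_div_cancel₀ hρ0.ne', div_self hq0.ne', one_smul]
      have h1 := hρ ((ρ / ‖q‖) • q) (‖q‖ / ρ) hn.ge hc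
      rw [hs] at h1
      rw [h1, norm_mul, Complex.norm_real, Real.norm_of_nonneg (by positivity), mul_comm]
      have h2 := hM ((ρ / ‖q‖) • q) (by rw [mem_closedBall_zero_iff, hn])
      have h3 : (‖q‖ / ρ) ^ m ≤ ((1 + ρ)⁻¹ * bracket 1 q) ^ m := by
        refine Real.rpow_le_rpow_of_nonpos (by positivity) ?_ hm
        rw [inv_mul_le_iff₀ (by positivity)]
        refine (hb1 q).trans ?_
        have : (1 + ρ) * (‖q‖ / ρ) = ‖q‖ / ρ + ‖q‖ := by field_simp
        rw [this]; linarith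
      exact mul_le_mul h2 h3 (by positivity) hM0
  refine ⟨N * (M * (1 + ρ) ^ (-m)), fun q => ?_⟩
  rw [norm_mul, Complex.norm_real, Real.norm_of_nonneg (Real.sqrt_nonneg _), mul_assoc]
  exact mul_le_mul (hμ q) (ha q) (norm_nonneg _) hN0

end Geometry

/-! ### The trace of a quantized canonical transformation -/

theorem proposition2 (d : ℕ) (hd : 0 < d) (κ : ℝ) (hκ : 0 < κ) (m s : ℝ)
    (hs : s < 0) (hsm : 0 < s - m - d)
    (g : SpaceM d × SpaceM d → SpaceM d × SpaceM d) (S : SpaceM d → SpaceM d → ℝ)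
    (μ : SpaceM d → ℝ) (a : SpaceM d → ℂ) (hΦ : IsQuantizationData g S μ a m) :
    ∃ KΦ : 𝓢'(SpaceM d × SpaceM d, ℂ),
      IsFourierInSnd κ (fioSymbol S μ a) KΦ ∧
      (∃! T, IsTrace KΦ m s T) ∧
      ∃ (D D' : SpaceX d → 𝓢'(SpaceX d × SpaceX d, ℂ)) (K K' : 𝓢'(SpaceX d × SpaceX d, ℂ)),
        (∀ τ', IsFourierInSnd κ (fun x p' => fioSymbol S μ a (mkM x 0) (mkM p' τ')) (D τ')) ∧
        IsDistrIntegral D K ∧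
        (∀ τ', IsFourierInFst κ (fun x p' => fioSymbol S μ a (mkM x 0) (mkM p' τ')) (D' τ')) ∧
        IsDistrIntegral D' K' ∧
        ∀ T, IsTrace KΦ m s T →
          HasSchwartzKernel (fun v => (T (.ofSchwartz s v)).toDistr) ((κ : ℂ) ^ d • K) ∧
          HasSchwartzKernel (dualOperator κ T) ((κ : ℂ) ^ d • K') := by
  have hm : m ≤ 0 := by
    have : (0 : ℝ) ≤ d := Nat.cast_nonneg d
    linarith
  have hmeas : Measurable fun q : SpaceM d => ((Real.sqrt (μ q) : ℝ) : ℂ) * a q := by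
    have h1 : Measurable μ := measurable_of_continuousOn_compl_singleton 0 hΦ.density_smooth.continuousOn
    have h2 := hΦ.amplitude_smooth.continuous.measurable
    fun_prop
  refine trace_of_phase hd hκ hs hsm (hΦ.isPhaseMap hd) hmeas (hΦ.exists_amplitude_le hm)
    (fun y q hq => ?_) (fun y q => ?_)
  · rw [fioSymbol, hΦ.generating_eq y hq]
  · rw [fioSymbol, norm_mul, mul_comm Complex.I, Complex.norm_exp_ofReal_mul_I, one_mul]
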